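/- **Problem.** Let $\xi$ be a random variable, $f(\cdot;\xi):\mathbb R^n\to\mathbb R$, $F(x)=\mathbb E_\xi[f(x;\xi)]$, let $r:\mathbb R^n\to\mathbb R\cup\{+\infty\}$ be proper, closed and convex (possibly nonsmooth), $\operatorname{dom}(r)=\{x: r(x)<\infty\}$, and let $\phi=F+r$ with $\phi^*=\inf_{x}\phi(x)>-\infty$. For $a>0$ put $\operatorname{prox}_{ar}(z)=\arg\min_y\{r(y)+\frac1{2a}\|y-z\|^2\}$, and let $\phi_\lambda(x)=\min_y\{\phi(y)+\frac1{2\lambda}\|y-x\|^2\}$ be the Moreau envelope of $\phi$. **Algorithm.** Choose $x^{(0)}\in\operatorname{dom}(r)$ and set $x^{(1)}=x^{(0)}$. For $k=1,\dots,K$ let $g^{(k)}=\nabla f(x^{(k-\tau_k)};\xi_k)$, where $\xi_k$ is a fresh sample of $\xi$ (independent of the past) and $\tau_k$ is a delay (fixed, or random and determined before $\xi_k$ is drawn), and $$x^{(k+1)}=\operatorname{prox}_{\alpha_k r}\big(x^{(k)}-\alpha_k g^{(k)}+\beta_k(x^{(k)}-x^{(k-1)})\big).$$ **Assumptions.** (i)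 $\mathbb E_{\xi_k}[g^{(k)}]=\nabla F(x^{(k-\tau_k)})$ for each $k$. (ii) $F$ is differentiable at the points of $\operatorname{dom}(r)$, and $\|\nabla F(x)-\nabla F(y)\|\le\rho\|x-y\|$ for all $x,y\in\operatorname{dom}(r)$, where $\rho\ge0$. (iii) $\mathbb E_\xi\|\nabla f(x;\xi)-\nabla F(x)\|^2\le\sigma^2$ for all $x\in\operatorname{dom}(r)$, where $\sigma\ge0$. (iv) $\tau_k\le\tau$ for all $k$, where $\tau$ is a nonnegative integer. **Theorem.** Let $\overline\rho>\rho$, let $K\ge1$ be the number of iterations, and let $\alpha_k=\frac{\alpha}{\sqrt K}$ and $\beta_k=\frac{\beta}{K^{1/4}}$ for $k=1,\dots,K$, where $\alpha>0$ and $\beta\ge0$ are such that $\frac{\alpha}{\sqrt K}\le\frac1{\overline\rho}$ and $$\tilde\gamma:=\frac12-\frac{\alpha\rho}{2\sqrt K}-\frac{\tau^2\alpha^2\rho^2}{K}-\frac{\beta}{K^{1/4}}>0.$$ Let $T$ be drawn from $\{1,\dots,K\}$, independently of the iterates, with $\mathrm{Prob}(T=k)=\alpha_k/\sum_{j=1}^K\alpha_j$.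 Then $\phi_{1/\overline\rho}$ is differentiable on $\mathbb R^n$, $\|\nabla\phi_{1/\overline\rho}(x^{(T)})\|^2$ is integrable, and $$\begin{aligned}\mathbb E\big\|\nabla\phi_{1/\overline\rho}(x^{(T)})\big\|^2\le{}&\frac{8\overline\rho}{(\overline\rho-\rho)\alpha\sqrt K}\Bigg[\phi_{1/\overline\rho}(x^{(1)})-\phi^*+\frac{\sigma^2\overline\rho\alpha^2}{2}\\&+\frac1{\tilde\gamma}\bigg(\overline\rho\Big(2+\frac{4\sqrt K}{\alpha(\overline\rho-\rho)}\Big)\frac{\beta^2}{\sqrt K}+\frac{\tau^2\overline\rho\rho^2}{2}\Big(\frac{\alpha^2}{K}+\frac{\alpha}{(\overline\rho-\rho)\sqrt K}\Big)\bigg)\Big(\frac{\alpha}{\sqrt K}\big(\phi(x^{(1)})-\phi^*\big)+\alpha^2\sigma^2\Big)\Bigg].\end{aligned}$$ -/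

import Mathlib

namespace InertialSGM

open scoped MeasureTheory

/-- The Euclidean space `ℝⁿ`. -/
abbrev Vec (n : ℕ) : Type := EuclideanSpace ℝ (Fin n)

/-- The effective domain `dom h` of an extended-real-valued function. -/
def effDom {n : ℕ} (h : Vec n → EReal) : Set (Vec n) := {x | h x < ⊤}

/-- `h : ℝⁿ → ℝ ∪ {+∞}` is proper, closed (lower semicontinuous) and convex; convexity is
convexity of the epigraph. -/
structure ProperClosedConvex {n : ℕ} (h : Vec n → EReal) : Prop where
  ne_bot : ∀ x, h x ≠ ⊥
  nonempty_dom : (effDom h).Nonempty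
  lsc : LowerSemicontinuous h
  convex_epi : Convex ℝ {p : Vec n × ℝ | h p.1 ≤ (p.2 : EReal)}

/-- `p = prox_{a h}(z)`, i.e. `p` minimizes `y ↦ h y + ‖y - z‖² / (2a)` over `ℝⁿ`. -/
def IsProx {n : ℕ} (a : ℝ) (h : Vec n → EReal) (z p : Vec n) : Prop :=
  ∀ y : Vec n, h p + ((1 / (2 * a) * ‖p - z‖ ^ 2 : ℝ) : EReal)
    ≤ h y + ((1 / (2 * a) * ‖y - z‖ ^ 2 : ℝ) : EReal)

/-- The Moreau envelope `φ_t(x) = inf_y { φ(y) + ‖y - x‖² / (2t) }`, as a real number. -/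
noncomputable def moreau {n : ℕ} (t : ℝ) (φ : Vec n → EReal) (x : Vec n) : ℝ :=
  (⨅ y : Vec n, φ y + ((1 / (2 * t) * ‖y - x‖ ^ 2 : ℝ) : EReal)).toReal

/-- The optimal value `φ^* = inf φ`, as a real number. -/
noncomputable def optVal {n : ℕ} (φ : Vec n → EReal) : ℝ := (⨅ x : Vec n, φ x).toReal

/-- The expected loss `F(x) = E_ξ f(x; ξ)`, where `D` is the law of `ξ`. -/
noncomputable def expLoss {n : ℕ} {Ξ : Type*} [MeasurableSpace Ξ]
    (D : MeasureTheory.Measure Ξ) (f : Vec n → Ξ → ℝ) (x : Vec n) : ℝ :=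
  ∫ s, f x s ∂D

/-- The composite objective `φ = F + r`. -/
noncomputable def objective {n : ℕ} (F : Vec n → ℝ) (r : Vec n → EReal) (x : Vec n) : EReal :=
  (F x : EReal) + r x

/-- The sample gradient `∇f(x; s)` with respect to `x`. -/
noncomputable def sampleGrad {n : ℕ} {Ξ : Type*} (f : Vec n → Ξ → ℝ) (x : Vec n) (s : Ξ) :
    Vec n :=
  gradient (fun y => f y s) x

/-- `F` is `ρ`-smooth in `S`. -/
structure SmoothIn {n : ℕ} (ρ : ℝ) (F : Vec n → ℝ) (S : Set (Vec n)) : Prop where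
  differentiableAt : ∀ x ∈ S, DifferentiableAt ℝ F x
  lipschitz : ∀ x ∈ S, ∀ y ∈ S, ‖gradient F x - gradient F y‖ ≤ ρ * ‖x - y‖

/-- Bounded variance on `S`: `E_ξ ‖∇f(x; ξ) - ∇F(x)‖² ≤ σ²` for all `x ∈ S`. -/
def BoundedVariance {n : ℕ} {Ξ : Type*} [MeasurableSpace Ξ] (D : MeasureTheory.Measure Ξ)
    (f : Vec n → Ξ → ℝ) (σ : ℝ) (S : Set (Vec n)) : Prop :=
  ∀ x ∈ S, ∫⁻ s, ENNReal.ofReal (‖sampleGrad f x s - gradient (expLoss D f) x‖ ^ 2) ∂D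
    ≤ ENNReal.ofReal (σ ^ 2)

/-- The randomness of a run of `K` iterations: `ℱ k` is the information available right before
the `k`-th sample is drawn, the delay `τ_k` belongs to it (in particular it may be deterministic),
and `ξ_k` is a fresh sample with law `D`. -/
structure IsSampling {Ω Ξ : Type*} {mΩ : MeasurableSpace Ω} [MeasurableSpace Ξ]
    (P : MeasureTheory.Measure Ω) (D : MeasureTheory.Measure Ξ)
    (ℱ : MeasureTheory.Filtration ℕ mΩ) (ξ : ℕ → Ω → Ξ) (delay : ℕ → Ω → ℕ) (K : ℕ) : Prop where
  delay_meas : ∀ k ∈ Finset.Icc 1 K, Measurable[ℱ k] (delay k)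
  sample_meas : ∀ k ∈ Finset.Icc 1 K, Measurable[ℱ (k + 1)] (ξ k)
  sample_law : ∀ k ∈ Finset.Icc 1 K, MeasureTheory.Measure.map (ξ k) P = D
  sample_indep : ∀ k ∈ Finset.Icc 1 K,
    ProbabilityTheory.Indep (MeasurableSpace.comap (ξ k) inferInstance) (ℱ k) P

/-- `x⁽⁰⁾, x⁽¹⁾, …, x⁽ᴷ⁺¹⁾` are the iterates of the distributed stochastic inertial (proximal)
gradient method with stepsizes `a k`, inertial parameters `b k`, samples `ξ k` and delays
`delay k`. The subtraction `k - delay k ω` is that of `ℕ`: a delay reaching behind the start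
refers to the starting point. -/
structure IsInertialRun {n : ℕ} {Ω Ξ : Type*} (f : Vec n → Ξ → ℝ) (r : Vec n → EReal)
    (a b : ℕ → ℝ) (ξ : ℕ → Ω → Ξ) (delay : ℕ → Ω → ℕ) (K : ℕ) (x₀ : Vec n)
    (x : ℕ → Ω → Vec n) : Prop where
  init_dom : x₀ ∈ effDom r
  init_zero : ∀ ω, x 0 ω = x₀
  init_one : ∀ ω, x 1 ω = x₀
  step : ∀ k ∈ Finset.Icc 1 K, ∀ ω,
    IsProx (a k) r
      (x k ω - a k • sampleGrad f (x (k - delay k ω) ω) (ξ k ω) + b k • (x k ω - x (k - 1) ω))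
      (x (k + 1) ω)

/-- Unbiasedness along the run: `E_{ξ_k}[g⁽ᵏ⁾] = ∇F(x⁽ᵏ⁻ᵗ⁾)` with `t = τ_k`, where
`g⁽ᵏ⁾ = ∇f(x⁽ᵏ⁻ᵗ⁾; ξ_k)` and `E_{ξ_k}` integrates over the fresh sample only. -/
def UnbiasedAlong {n : ℕ} {Ω Ξ : Type*} [MeasurableSpace Ω] [MeasurableSpace Ξ]
    (P : MeasureTheory.Measure Ω) (D : MeasureTheory.Measure Ξ) (f : Vec n → Ξ → ℝ)
    (delay : ℕ → Ω → ℕ) (K : ℕ) (x : ℕ → Ω → Vec n) : Prop :=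
  ∀ k ∈ Finset.Icc 1 K, ∀ᵐ ω ∂P,
    ∫ s, sampleGrad f (x (k - delay k ω) ω) s ∂D
      = gradient (expLoss D f) (x (k - delay k ω) ω)

/-- `T` is drawn from `{1, …, K}` with `Prob(T = k) = a k / ∑_{j=1}^K a j`, independently of the
iterates. -/
structure IsRandomIndex {n : ℕ} {Ω : Type*} [MeasurableSpace Ω] (P : MeasureTheory.Measure Ω)
    (a : ℕ → ℝ) (K : ℕ) (x : ℕ → Ω → Vec n) (T : Ω → ℕ) : Prop where
  measurable : Measurable T
  law : ∀ k ∈ Finset.Icc 1 K, P.real {ω | T ω = k} = a k / ∑ j ∈ Finset.Icc 1 K, a j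
  indep : ProbabilityTheory.IndepFun T (fun ω (k : Fin (K + 1)) => x k ω) P

end InertialSGM

open InertialSGM

namespace InertialSGM

open Filter Topology MeasureTheory ProbabilityTheory
open scoped InnerProductSpace

/-! ### Proximal points of `r` and of the composite objective. -/

section ConvexAnalysis

variable {n : ℕ} {r : Vec n → EReal} {F : Vec n → ℝ} {ρ : ℝ}

/-! Let `p` be the proximal point of the iterate `x` for `φ` with parameter `1 / ρbar`. It is unique
and Lipschitz in `x` because `φ` is weakly convex with constant `ρ < ρbar`, and the envelope has
gradient `ρbar • (x - p)`. The quantity to bound is therefore `ρbar ^ 2 * ‖x - p‖ ^ 2`.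

The point `p` is a fixed point of an undelayed, noiseless proximal gradient step on `F + r` plus a
quadratic pulling towards `x`. Comparing it with the actual step (`IsProx.norm_sub_prox_le`) gives
`‖xnext - p‖ ≤ ‖u - a • e‖`, where `e` is the sampling noise and `u` (`drift`) is known before the
sample is drawn. Up to delay and inertia, `u` is shorter than `x - p` by the factor `1 - a * (ρbar -
ρ)` (`norm_drift_le`). Since `p` is a competitor in the envelope at `xnext`, each step lowers the
envelope by a multiple of `‖x - p‖ ^ 2`, up to errors (`IsProx.moreau_step`).

The delay and inertia errors are controlled by `S`, the sum of the squared step lengths. A separate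
descent argument on `φ` itself bounds `S` by the initial gap and the noise; the constant `γ` is what
remains of the descent once these errors are absorbed (`sum_norm_sub_sq_le`).

Both sums are estimated for each realization, and expectations are taken only at the end. There `⟪u,
e⟫` has mean zero because the sample is independent of the past (`integral_inner_noise_eq_zero`),
and the squared noise has mean at most `σ ^ 2`. Averaging over the random index gives the theorem.
-/

theorem mem_effDom {h : Vec n → EReal} {x : Vec n} : x ∈ effDom h ↔ h x < ⊤ := Iff.rfl

theorem not_mem_effDom {h : Vec n → EReal} {x : Vec n} : x ∉ effDom h ↔ h x = ⊤ := by
  rw [mem_effDom, not_lt_top_iff]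

theorem ProperClosedConvex.coe_toReal (hr : ProperClosedConvex r) {x : Vec n}
    (hx : x ∈ effDom r) : ((r x).toReal : EReal) = r x :=
  EReal.coe_toReal (ne_of_lt hx) (hr.ne_bot x)

theorem ProperClosedConvex.convexOn (hr : ProperClosedConvex r) :
    ConvexOn ℝ (effDom r) (fun x => (r x).toReal) := by
  have key : ∀ x ∈ effDom r, ∀ y ∈ effDom r, ∀ s t : ℝ, 0 ≤ s → 0 ≤ t → s + t = 1 →
      r (s • x + t • y) ≤ ((s * (r x).toReal + t * (r y).toReal : ℝ) : EReal) := by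
    intro x hx y hy s t hs ht hst
    have h := hr.convex_epi (x := (x, (r x).toReal)) (y := (y, (r y).toReal))
      (by simp [hr.coe_toReal hx]) (by simp [hr.coe_toReal hy]) hs ht hst
    simpa using h
  have hmem : ∀ x ∈ effDom r, ∀ y ∈ effDom r, ∀ s t : ℝ, 0 ≤ s → 0 ≤ t → s + t = 1 →
      s • x + t • y ∈ effDom r := fun x hx y hy s t hs ht hst =>
    lt_of_le_of_lt (key x hx y hy s t hs ht hst) (EReal.coe_lt_top _)
  refine ⟨fun x hx y hy s t hs ht hst => hmem x hx y hy s t hs ht hst, ?_⟩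
  intro x hx y hy s t hs ht hst
  have h := key x hx y hy s t hs ht hst
  rw [← hr.coe_toReal (hmem x hx y hy s t hs ht hst)] at h
  simpa using EReal.coe_le_coe_iff.1 h

/-- First-order optimality for the sum of a convex function and a function that is differentiable
at the minimizer. -/
theorem le_add_inner_of_forall_add_le {S : Set (Vec n)} {R G : Vec n → ℝ} {v p : Vec n}
    (hR : ConvexOn ℝ S R) (hp : p ∈ S) (hG : HasGradientAt G v p)
    (hmin : ∀ y ∈ S, G p + R p ≤ G y + R y) {y : Vec n} (hy : y ∈ S) :
    R p ≤ R y + ⟪v, y - p⟫_ℝ := by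
  have hline : HasDerivAt (fun t : ℝ => G (p + t • (y - p))) ⟪v, y - p⟫_ℝ 0 := by
    have h1 : HasDerivAt (fun t : ℝ => p + t • (y - p)) (y - p) 0 := by
      simpa using ((hasDerivAt_id (0 : ℝ)).smul_const (y - p)).const_add p
    have h2 : HasFDerivAt G (InnerProductSpace.toDual ℝ (Vec n) v) (p + (0 : ℝ) • (y - p)) := by
      simpa using hG.hasFDerivAt
    have h3 := h2.comp_hasDerivAt (0 : ℝ) h1
    rwa [InnerProductSpace.toDual_apply_apply] at h3
  have ht := hline.tendsto_slope_zero_right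
  -- Minimality at `p + t • (y - p)`, with `R` there bounded by convexity, bounds the difference
  -- quotient of `G` below; then `t → 0+`.
  have hev : ∀ᶠ t : ℝ in 𝓝[>] 0, R p - R y ≤
      t⁻¹ • (G (p + (0 + t) • (y - p)) - G (p + (0 : ℝ) • (y - p))) := by
    have : Set.Ioc (0 : ℝ) 1 ∈ 𝓝[>] (0 : ℝ) := Ioc_mem_nhdsGT one_pos
    filter_upwards [this] with t (ht : 0 < t ∧ t ≤ 1)
    have hc : p + t • (y - p) = (1 - t) • p + t • y := by module
    have hmem : (1 - t) • p + t • y ∈ S :=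
      hR.1 hp hy (by linarith [ht.2]) ht.1.le (by ring)
    have hval := hR.2 hp hy (show 0 ≤ 1 - t by linarith [ht.2]) ht.1.le (by ring)
    have hm := hmin _ hmem
    simp only [smul_eq_mul] at hval
    rw [zero_add, zero_smul, add_zero, hc, smul_eq_mul, inv_mul_eq_div, le_div_iff₀ ht.1]
    linarith
  have := ge_of_tendsto ht hev
  linarith

theorem hasGradientAt_const_mul_norm_sub_sq (c : ℝ) (z p : Vec n) :
    HasGradientAt (fun y => c * ‖y - z‖ ^ 2) ((2 * c) • (p - z)) p := by
  have h := ((hasFDerivAt_id p).sub_const z).norm_sq.const_mul c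
  rw [hasGradientAt_iff_hasFDerivAt]
  refine h.congr_fderiv ?_
  ext w
  simp
  ring

theorem hasGradientAt_add {G H : Vec n → ℝ} {u v p : Vec n} (hG : HasGradientAt G u p)
    (hH : HasGradientAt H v p) : HasGradientAt (fun y => G y + H y) (u + v) p := by
  rw [hasGradientAt_iff_hasFDerivAt, map_add]
  exact hG.hasFDerivAt.add hH.hasFDerivAt

theorem IsProx.mem_effDom {a : ℝ} {h : Vec n → EReal} {z p y : Vec n} (hp : IsProx a h z p)
    (hy : y ∈ effDom h) : p ∈ effDom h := by
  have h1 := hp y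
  have h2 : h y + ((1 / (2 * a) * ‖y - z‖ ^ 2 : ℝ) : EReal) < ⊤ :=
    EReal.add_lt_top (ne_of_lt hy) (EReal.coe_ne_top _)
  refine InertialSGM.mem_effDom.2 (lt_top_iff_ne_top.2 fun htop => ?_)
  rw [htop, EReal.top_add_coe] at h1
  exact absurd h2 (not_lt.2 h1)

theorem effDom_objective (r : Vec n → EReal) (F : Vec n → ℝ) :
    effDom (objective F r) = effDom r := by
  ext x
  simp only [mem_effDom, objective, lt_top_iff_ne_top]
  constructor
  · intro h h'
    exact h (by rw [h', EReal.coe_add_top])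
  · intro h
    exact (EReal.add_lt_top (EReal.coe_ne_top _) h).ne

theorem ProperClosedConvex.toReal_objective (hr : ProperClosedConvex r) {x : Vec n}
    (hx : x ∈ effDom r) : (objective F r x).toReal = F x + (r x).toReal := by
  rw [objective, ← hr.coe_toReal hx, ← EReal.coe_add, EReal.toReal_coe, EReal.toReal_coe]

theorem ProperClosedConvex.coe_objective (hr : ProperClosedConvex r) {x : Vec n}
    (hx : x ∈ effDom r) : objective F r x = ((F x + (r x).toReal : ℝ) : EReal) := by
  rw [EReal.coe_add, hr.coe_toReal hx, objective]

/-- The variational inequality of the minimizer defining `prox_{a (G + r)}(z)`, where `G` is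
differentiable. -/
theorem IsProx.variational_objective (hr : ProperClosedConvex r) {a : ℝ} {z p : Vec n}
    (hp : IsProx a (objective F r) z p) (hF : DifferentiableAt ℝ F p) :
    ∀ y ∈ effDom r, (r p).toReal ≤ (r y).toReal + ⟪gradient F p + (1 / a) • (p - z), y - p⟫_ℝ := by
  obtain ⟨x₀, hx₀⟩ := hr.nonempty_dom
  have hpd : p ∈ effDom r := by
    rw [← effDom_objective r F] at hx₀ ⊢
    exact hp.mem_effDom hx₀
  have hG := hasGradientAt_add hF.hasGradientAt (hasGradientAt_const_mul_norm_sub_sq (1 / (2 * a)) z p)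
  have hco : 2 * (1 / (2 * a)) = 1 / a := by
    rcases eq_or_ne a 0 with rfl | ha
    · simp
    · field_simp
  rw [hco] at hG
  intro y hy
  refine le_add_inner_of_forall_add_le hr.convexOn hpd hG (fun y hy => ?_) hy
  have h := hp y
  rw [hr.coe_objective hpd, hr.coe_objective hy, ← EReal.coe_add, ← EReal.coe_add,
    EReal.coe_le_coe_iff] at h
  linarith

theorem objective_zero (r : Vec n → EReal) : objective (fun _ => 0) r = r := by
  funext x
  simp [objective]

theorem IsProx.variational (hr : ProperClosedConvex r) {a : ℝ} {z p : Vec n}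
    (hp : IsProx a r z p) :
    ∀ y ∈ effDom r, (r p).toReal ≤ (r y).toReal + ⟪(1 / a) • (p - z), y - p⟫_ℝ := by
  rw [← objective_zero r] at hp
  intro y hy
  simpa using hp.variational_objective hr (differentiableAt_const 0) y hy

theorem IsProx.norm_sub_le (hr : ProperClosedConvex r) {a : ℝ} (ha : 0 < a) {z z' p p' : Vec n}
    (hp : IsProx a r z p) (hp' : IsProx a r z' p') : ‖p - p'‖ ≤ ‖z - z'‖ := by
  obtain ⟨x₀, hx₀⟩ := hr.nonempty_dom
  have h1 := hp.variational hr p' (hp'.mem_effDom hx₀)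
  have h2 := hp'.variational hr p (hp.mem_effDom hx₀)
  have e : ⟪(1 / a) • (p - z), p' - p⟫_ℝ + ⟪(1 / a) • (p' - z'), p - p'⟫_ℝ
      = (1 / a) * (⟪z - z', p - p'⟫_ℝ - ‖p - p'‖ ^ 2) := by
    rw [← real_inner_self_eq_norm_sq]
    simp only [inner_smul_left, inner_sub_left, inner_sub_right, RCLike.conj_to_real]
    ring
  have h3 : 0 ≤ (1 / a) * (⟪z - z', p - p'⟫_ℝ - ‖p - p'‖ ^ 2) := by linarith
  have h4 := nonneg_of_mul_nonneg_right h3 (by positivity)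
  have h5 := real_inner_le_norm (z - z') (p - p')
  rcases (norm_nonneg (p - p')).eq_or_lt with h0 | h0
  · rw [← h0]; exact norm_nonneg _
  · refine le_of_mul_le_mul_right ?_ h0
    nlinarith

/-- The descent lemma on a convex set. -/
theorem SmoothIn.le_add_inner {S : Set (Vec n)} (hS : Convex ℝ S) (hF : SmoothIn ρ F S)
    {x y : Vec n} (hx : x ∈ S) (hy : y ∈ S) :
    F y ≤ F x + ⟪gradient F x, y - x⟫_ℝ + ρ / 2 * ‖y - x‖ ^ 2 := by
  -- `F` along the segment minus its linear and quadratic model; the Lipschitz gradient makes `H`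
  -- nonincreasing.
  set H : ℝ → ℝ := fun t => F (x + t • (y - x)) - t * ⟪gradient F x, y - x⟫_ℝ
    - t ^ 2 * (ρ / 2 * ‖y - x‖ ^ 2) with hH
  have hmem : ∀ t ∈ Set.Icc (0 : ℝ) 1, x + t • (y - x) ∈ S := fun t ht =>
    hS.add_smul_sub_mem hx hy ht
  have hder : ∀ t ∈ Set.Icc (0 : ℝ) 1, HasDerivAt H
      (⟪gradient F (x + t • (y - x)), y - x⟫_ℝ - 1 * ⟪gradient F x, y - x⟫_ℝ
        - (2 : ℕ) * t ^ (2 - 1) * (ρ / 2 * ‖y - x‖ ^ 2)) t := by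
    intro t ht
    have h1 : HasDerivAt (fun t : ℝ => x + t • (y - x)) (y - x) t := by
      simpa using ((hasDerivAt_id t).smul_const (y - x)).const_add x
    have h2 := (hF.differentiableAt _ (hmem t ht)).hasGradientAt.hasFDerivAt
    have h3 := h2.comp_hasDerivAt t h1
    simp only [InnerProductSpace.toDual_apply_apply] at h3
    exact (h3.sub ((hasDerivAt_id t).mul_const _)).sub ((hasDerivAt_pow 2 t).mul_const _)
  have hanti : AntitoneOn H (Set.Icc 0 1) := by
    refine antitoneOn_of_deriv_nonpos (convex_Icc 0 1)
      (fun t ht => (hder t ht).continuousAt.continuousWithinAt)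
      (fun t ht => (hder t (interior_subset ht)).differentiableAt.differentiableWithinAt) ?_
    intro t ht
    have ht' := interior_subset ht
    rw [(hder t ht').deriv]
    have h1 := hF.lipschitz _ (hmem t ht') _ hx
    rw [add_sub_cancel_left, norm_smul, Real.norm_of_nonneg ht'.1] at h1
    have h2 := real_inner_le_norm (gradient F (x + t • (y - x)) - gradient F x) (y - x)
    rw [inner_sub_left] at h2
    have h3 := mul_le_mul_of_nonneg_right h1 (norm_nonneg (y - x))
    push_cast
    nlinarith
  have h := hanti (Set.left_mem_Icc.2 zero_le_one) (Set.right_mem_Icc.2 zero_le_one) zero_le_one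
  simp only [hH, one_smul, zero_smul, add_zero, add_sub_cancel] at h
  linarith

/-- The descent lemma with `x` and `y` exchanged; moving the gradient back to `x` costs another `ρ *
‖y - x‖ ^ 2`. The constant is not sharp: only a continuous minorant of `F` on the domain is needed.
-/
theorem SmoothIn.add_inner_le {S : Set (Vec n)} (hS : Convex ℝ S) (hF : SmoothIn ρ F S)
    {x y : Vec n} (hx : x ∈ S) (hy : y ∈ S) :
    F x + ⟪gradient F x, y - x⟫_ℝ - 3 * ρ / 2 * ‖y - x‖ ^ 2 ≤ F y := by
  have h1 := hF.le_add_inner hS hy hx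
  have h2 := hF.lipschitz x hx y hy
  have h3 := real_inner_le_norm (gradient F x - gradient F y) (y - x)
  have h4 := mul_le_mul_of_nonneg_right h2 (norm_nonneg (y - x))
  rw [inner_sub_left] at h3
  rw [norm_sub_rev x y] at h1 h4
  have h5 : ⟪gradient F y, x - y⟫_ℝ = - ⟪gradient F y, y - x⟫_ℝ := by
    rw [← inner_neg_right, neg_sub]
  nlinarith

/-- Nothing is known about `F` off the domain of `r`. At a point outside it, nearby domain points
have `F` above a continuous quadratic while `r` becomes arbitrarily large; elsewhere the objective
is `⊤`. -/
theorem ProperClosedConvex.lowerSemicontinuous_objective (hr : ProperClosedConvex r)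
    (hF : SmoothIn ρ F (effDom r)) : LowerSemicontinuous (objective F r) := by
  intro y
  by_cases hy : y ∈ effDom r
  · have h1 : LowerSemicontinuousAt (fun x => (F x : EReal)) y :=
      (continuous_coe_real_ereal.continuousAt.comp
        (hF.differentiableAt y hy).continuousAt).lowerSemicontinuousAt
    exact h1.add' (hr.lsc y)
      (EReal.continuousAt_add (Or.inl (EReal.coe_ne_top _)) (Or.inl (EReal.coe_ne_bot _)))
  · have hry : r y = ⊤ := not_mem_effDom.1 hy
    obtain ⟨x₀, hx₀⟩ := hr.nonempty_dom
    set l : Vec n → ℝ := fun z =>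
      F x₀ + ⟪gradient F x₀, z - x₀⟫_ℝ - 3 * ρ / 2 * ‖z - x₀‖ ^ 2 with hl
    have hlc : Continuous l := by fun_prop
    intro c _
    have hc : ∃ c' : ℝ, c ≤ c' := by
      induction c with
      | bot => exact ⟨0, bot_le⟩
      | coe c => exact ⟨c, le_rfl⟩
      | top => simp_all
    obtain ⟨c', hc'⟩ := hc
    have e1 : ∀ᶠ z in 𝓝 y, l y - 1 < l z :=
      hlc.continuousAt.eventually (lt_mem_nhds (by linarith))
    have e2 : ∀ᶠ z in 𝓝 y, ((c' - (l y - 1) : ℝ) : EReal) < r z :=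
      hr.lsc y _ (by simp only [hry]; exact EReal.coe_lt_top _)
    filter_upwards [e1, e2] with z h1 h2
    by_cases hz : z ∈ effDom r
    · have h3 : l z ≤ F z := hF.add_inner_le hr.convexOn.1 hx₀ hz
      rw [hr.coe_objective hz]
      rw [← hr.coe_toReal hz, EReal.coe_lt_coe_iff] at h2
      exact lt_of_le_of_lt hc' (EReal.coe_lt_coe_iff.2 (by linarith))
    · rw [objective, not_mem_effDom.1 hz, EReal.coe_add_top]
      exact lt_of_le_of_lt hc' (EReal.coe_lt_top _)

theorem ProperClosedConvex.iInf_objective_ne_top (hr : ProperClosedConvex r) :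
    (⨅ x, objective F r x) ≠ ⊤ := by
  obtain ⟨x₀, hx₀⟩ := hr.nonempty_dom
  refine ((iInf_le _ x₀).trans_lt ?_).ne
  rwa [← effDom_objective r F] at hx₀

theorem ProperClosedConvex.coe_optVal_le (hr : ProperClosedConvex r)
    (hb : (⨅ x, objective F r x) ≠ ⊥) (y : Vec n) :
    (optVal (objective F r) : EReal) ≤ objective F r y := by
  rw [optVal, EReal.coe_toReal hr.iInf_objective_ne_top hb]
  exact iInf_le _ y

theorem ProperClosedConvex.optVal_le (hr : ProperClosedConvex r)
    (hb : (⨅ x, objective F r x) ≠ ⊥) {y : Vec n} (hy : y ∈ effDom r) :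
    optVal (objective F r) ≤ F y + (r y).toReal := by
  have h := hr.coe_optVal_le hb y
  rwa [hr.coe_objective hy, EReal.coe_le_coe_iff] at h

/-- Since `φ` is bounded below, the quadratic term makes the problem coercive: outside a ball the
value is at least that at `x₀`, and inside it compactness and lower semicontinuity apply. -/
theorem exists_isProx_objective (hr : ProperClosedConvex r) (hF : SmoothIn ρ F (effDom r))
    (hb : (⨅ x, objective F r x) ≠ ⊥) {t : ℝ} (ht : 0 < t) (x : Vec n) :
    ∃ p, IsProx t (objective F r) x p := by
  obtain ⟨x₀, hx₀⟩ := hr.nonempty_dom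
  set Q : Vec n → EReal := fun y =>
    objective F r y + ((1 / (2 * t) * ‖y - x‖ ^ 2 : ℝ) : EReal) with hQ
  have hQlsc : LowerSemicontinuous Q := by
    intro y
    have h1 : ContinuousAt (fun y => ((1 / (2 * t) * ‖y - x‖ ^ 2 : ℝ) : EReal)) y := by
      refine (continuous_coe_real_ereal.comp ?_).continuousAt
      fun_prop
    have h2 : LowerSemicontinuousAt (objective F r) y := hr.lowerSemicontinuous_objective hF y
    exact h2.add' h1.lowerSemicontinuousAt
      (EReal.continuousAt_add (Or.inr (EReal.coe_ne_bot _)) (Or.inr (EReal.coe_ne_top _)))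
  set m := optVal (objective F r)
  set M := F x₀ + (r x₀).toReal + 1 / (2 * t) * ‖x₀ - x‖ ^ 2 with hM
  have hQx₀ : Q x₀ = (M : EReal) := by
    simp only [hQ]
    rw [hr.coe_objective hx₀, ← EReal.coe_add]
  have hmM : m ≤ M := by
    have := hr.optVal_le hb hx₀
    have : 0 ≤ 1 / (2 * t) * ‖x₀ - x‖ ^ 2 := by positivity
    linarith
  have hout : ∀ y, y ∉ Metric.closedBall x (√(2 * t * (M - m))) → (M : EReal) ≤ Q y := by
    intro y hy
    rw [Metric.mem_closedBall, dist_eq_norm, not_le] at hy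
    have h1 : 2 * t * (M - m) ≤ ‖y - x‖ ^ 2 := (Real.sqrt_le_left (norm_nonneg _)).1 hy.le
    have h2 : M - m ≤ 1 / (2 * t) * ‖y - x‖ ^ 2 := by
      rw [one_div, inv_mul_eq_div, le_div_iff₀ (by positivity)]
      linarith
    calc (M : EReal) ≤ ((m + 1 / (2 * t) * ‖y - x‖ ^ 2 : ℝ) : EReal) :=
          EReal.coe_le_coe_iff.2 (by linarith)
      _ = (m : EReal) + ((1 / (2 * t) * ‖y - x‖ ^ 2 : ℝ) : EReal) := EReal.coe_add _ _
      _ ≤ Q y := add_le_add_left (hr.coe_optVal_le hb y) _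
  obtain ⟨p, -, hp⟩ := LowerSemicontinuousOn.exists_isMinOn
    (s := Metric.closedBall x (√(2 * t * (M - m)))) ⟨x, Metric.mem_closedBall_self (Real.sqrt_nonneg _)⟩
    (isCompact_closedBall _ _) (hQlsc.lowerSemicontinuousOn _)
  by_cases hpM : Q p ≤ M
  · refine ⟨p, fun y => ?_⟩
    by_cases hy : y ∈ Metric.closedBall x (√(2 * t * (M - m)))
    · exact hp hy
    · exact hpM.trans (hout y hy)
  -- If even the minimum over the ball exceeds the value `M` at `x₀`, then `x₀` itself is a global
  -- minimizer.
  · refine ⟨x₀, fun y => ?_⟩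
    change Q x₀ ≤ Q y
    rw [hQx₀]
    by_cases hy : y ∈ Metric.closedBall x (√(2 * t * (M - m)))
    · exact (not_le.1 hpM).le.trans (hp hy)
    · exact hout y hy

end ConvexAnalysis

/-! ### Differentiability of the Moreau envelope. -/

section MoreauEnvelope

variable {n : ℕ} {r : Vec n → EReal} {F : Vec n → ℝ} {ρ ρbar : ℝ}

theorem moreau_eq (hr : ProperClosedConvex r) {x p : Vec n}
    (hp : IsProx (1 / ρbar) (objective F r) x p) (hpd : p ∈ effDom r) :
    moreau (1 / ρbar) (objective F r) x = F p + (r p).toReal + ρbar / 2 * ‖p - x‖ ^ 2 := by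
  have h : (⨅ y, objective F r y + ((1 / (2 * (1 / ρbar)) * ‖y - x‖ ^ 2 : ℝ) : EReal))
      = objective F r p + ((1 / (2 * (1 / ρbar)) * ‖p - x‖ ^ 2 : ℝ) : EReal) :=
    le_antisymm (iInf_le _ p) (le_iInf hp)
  have hc : 1 / (2 * (1 / ρbar)) = ρbar / 2 := by
    rw [mul_one_div, one_div_div]
  rw [moreau, h, hr.coe_objective hpd, ← EReal.coe_add, EReal.toReal_coe, hc]

theorem moreau_le (hr : ProperClosedConvex r) {x p y : Vec n}
    (hp : IsProx (1 / ρbar) (objective F r) x p) (hpd : p ∈ effDom r) (hy : y ∈ effDom r) :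
    moreau (1 / ρbar) (objective F r) x ≤ F y + (r y).toReal + ρbar / 2 * ‖y - x‖ ^ 2 := by
  have h := hp y
  have hc : 1 / (2 * (1 / ρbar)) = ρbar / 2 := by
    rw [mul_one_div, one_div_div]
  rw [hr.coe_objective hpd, hr.coe_objective hy, ← EReal.coe_add, ← EReal.coe_add,
    EReal.coe_le_coe_iff, hc] at h
  rwa [moreau_eq hr hp hpd]

/-- The proximal map of a weakly convex objective is Lipschitz. -/
theorem IsProx.norm_sub_le_of_smoothIn (hr : ProperClosedConvex r)
    (hF : SmoothIn ρ F (effDom r)) {x x' p p' : Vec n}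
    (hp : IsProx (1 / ρbar) (objective F r) x p) (hpd : p ∈ effDom r)
    (hp' : IsProx (1 / ρbar) (objective F r) x' p') (hpd' : p' ∈ effDom r) (hρbar : 0 ≤ ρbar) :
    (ρbar - ρ) * ‖p - p'‖ ≤ ρbar * ‖x - x'‖ := by
  have h1 := hp.variational_objective hr (hF.differentiableAt p hpd) p' hpd'
  have h2 := hp'.variational_objective hr (hF.differentiableAt p' hpd') p hpd
  rw [one_div_one_div] at h1 h2
  have e : ⟪gradient F p + ρbar • (p - x), p' - p⟫_ℝ
        + ⟪gradient F p' + ρbar • (p' - x'), p - p'⟫_ℝ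
      = ρbar * ⟪x - x', p - p'⟫_ℝ - ρbar * ‖p - p'‖ ^ 2
        - ⟪gradient F p - gradient F p', p - p'⟫_ℝ := by
    rw [← real_inner_self_eq_norm_sq]
    simp only [inner_smul_left, inner_sub_left, inner_sub_right, inner_add_left,
      RCLike.conj_to_real]
    ring
  have h3 := neg_le_of_abs_le (abs_real_inner_le_norm (gradient F p - gradient F p') (p - p'))
  have h4 := mul_le_mul_of_nonneg_right (hF.lipschitz p hpd p' hpd') (norm_nonneg (p - p'))
  have h5 := mul_le_mul_of_nonneg_left (real_inner_le_norm (x - x') (p - p')) hρbar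
  rcases (norm_nonneg (p - p')).eq_or_lt with h0 | h0
  · rw [← h0, mul_zero]; positivity
  · refine le_of_mul_le_mul_right ?_ h0
    nlinarith

/-- The Moreau envelope of a weakly convex objective is differentiable, and its gradient is
`ρbar (x - prox x)`. -/
theorem hasGradientAt_moreau (hr : ProperClosedConvex r) (hF : SmoothIn ρ F (effDom r))
    (hρ : 0 ≤ ρ) (hρbar : ρ < ρbar) {p : Vec n → Vec n}
    (hp : ∀ x, IsProx (1 / ρbar) (objective F r) x (p x)) (hpd : ∀ x, p x ∈ effDom r)
    (x : Vec n) :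
    HasGradientAt (moreau (1 / ρbar) (objective F r)) (ρbar • (x - p x)) x := by
  have hpos : 0 < ρbar := hρ.trans_lt hρbar
  -- The proximal point of `x` is a competitor in the envelope at `y`.
  have upper : ∀ x y, moreau (1 / ρbar) (objective F r) y - moreau (1 / ρbar) (objective F r) x
      ≤ ρbar * ⟪x - p x, y - x⟫_ℝ + ρbar / 2 * ‖y - x‖ ^ 2 := by
    intro x y
    have h1 := moreau_le hr (hp y) (hpd y) (hpd x)
    rw [moreau_eq hr (hp x) (hpd x)]
    have e : ‖p x - y‖ ^ 2 = ‖p x - x‖ ^ 2 + 2 * ⟪x - p x, y - x⟫_ℝ + ‖y - x‖ ^ 2 := by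
      rw [show p x - y = (p x - x) - (y - x) by abel, norm_sub_sq_real,
        show x - p x = -(p x - x) by abel, inner_neg_left]
      ring
    rw [e] at h1
    linarith
  rw [hasGradientAt_iff_isLittleO]
  refine Asymptotics.IsBigO.trans_isLittleO (g := fun y => ‖y - x‖ ^ 2) ?_
    (Asymptotics.isLittleO_pow_sub_sub x one_lt_two)
  refine Asymptotics.IsBigO.of_bound (ρbar * (ρbar / (ρbar - ρ) + 1)) (Eventually.of_forall ?_)
  intro y
  have h1 := upper x y
  -- Exchanging the points gives a lower bound whose linear term is based at `y`; the Lipschitz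
  -- bound on `p` moves it to `x` at quadratic cost.
  have h2 := upper y x
  have hδ : 0 < ρbar - ρ := by linarith
  have hL : ‖p y - p x‖ ≤ ρbar / (ρbar - ρ) * ‖y - x‖ := by
    rw [div_mul_eq_mul_div, le_div_iff₀ hδ, mul_comm]
    exact (hp y).norm_sub_le_of_smoothIn hr hF (hpd y) (hp x) (hpd x) hpos.le
  have h3 : ⟪p y - p x, y - x⟫_ℝ ≤ ρbar / (ρbar - ρ) * ‖y - x‖ ^ 2 := by
    have := real_inner_le_norm (p y - p x) (y - x)
    nlinarith [norm_nonneg (y - x)]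
  have e : ⟪y - p y, x - y⟫_ℝ
      = - ⟪x - p x, y - x⟫_ℝ + ⟪p y - p x, y - x⟫_ℝ - ‖y - x‖ ^ 2 := by
    rw [← real_inner_self_eq_norm_sq]
    simp only [inner_sub_left, inner_sub_right]
    ring
  rw [e, norm_sub_rev x y] at h2
  have h3' := mul_le_mul_of_nonneg_left h3 hpos.le
  have hq : 0 ≤ ρbar * ‖y - x‖ ^ 2 := by positivity
  have hLq : 0 ≤ ρbar * (ρbar / (ρbar - ρ) * ‖y - x‖ ^ 2) := by positivity
  rw [inner_smul_left, RCLike.conj_to_real, Real.norm_eq_abs, norm_pow, norm_norm, abs_le]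
  constructor <;> nlinarith

end MoreauEnvelope

/-! ### Pathwise descent estimates. -/

section Path

variable {n : ℕ} {r : Vec n → EReal} {F : Vec n → ℝ} {ρ ρbar a b : ℝ}

/-- One step of the method decreases the objective up to the delay, noise and inertia errors. -/
theorem IsProx.objective_step (hr : ProperClosedConvex r) (hF : SmoothIn ρ F (effDom r))
    (ha : 0 < a) (hb : 0 ≤ b) {x xprev xnext y g : Vec n} (hx : x ∈ effDom r)
    (hy : y ∈ effDom r) (hp : IsProx a r (x - a • g + b • (x - xprev)) xnext) :
    a * ((F xnext + (r xnext).toReal) - (F x + (r x).toReal))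
      ≤ -(1 / 2 - a * ρ / 2) * ‖xnext - x‖ ^ 2 + a ^ 2 * (ρ ^ 2 * ‖x - y‖ ^ 2)
        + a ^ 2 * ‖g - gradient F y‖ ^ 2
        + b / 2 * (‖xnext - x‖ ^ 2 + ‖x - xprev‖ ^ 2) := by
  have hn : xnext ∈ effDom r := hp.mem_effDom hx
  have h1 := hp.variational hr x hx
  have h2 := hF.le_add_inner hr.convexOn.1 hx hn
  have h3 := hF.lipschitz x hx y hy
  set d := xnext - x with hd
  have e1 : ⟪(1 / a) • (xnext - (x - a • g + b • (x - xprev))), x - xnext⟫_ℝ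
      = (1 / a) * (-‖d‖ ^ 2 - a * ⟪g, d⟫_ℝ + b * ⟪x - xprev, d⟫_ℝ) := by
    rw [show x - xnext = -d by rw [hd]; abel,
      show xnext - (x - a • g + b • (x - xprev)) = d + a • g - b • (x - xprev) by rw [hd]; abel,
      ← real_inner_self_eq_norm_sq]
    simp only [inner_smul_left, inner_sub_left, inner_add_left, inner_neg_right,
      RCLike.conj_to_real]
    ring
  rw [e1] at h1
  have h1' := mul_le_mul_of_nonneg_left h1 ha.le
  rw [mul_add, ← mul_assoc a (1 / a), mul_one_div_cancel ha.ne', one_mul] at h1'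
  have h2' := mul_le_mul_of_nonneg_left h2 ha.le
  have s1 : ⟪gradient F x, d⟫_ℝ - ⟪g, d⟫_ℝ
      = ⟪gradient F x - gradient F y, d⟫_ℝ - ⟪g - gradient F y, d⟫_ℝ := by
    simp only [inner_sub_left]; ring
  -- The proximal inequality supplies `-‖d‖ ^ 2`. Delay and noise each use up a quarter of it by
  -- Young's inequality, which leaves the `1 / 2` of `γ`.
  have y1 : a * ⟪gradient F x - gradient F y, d⟫_ℝ
      ≤ a ^ 2 * (ρ ^ 2 * ‖x - y‖ ^ 2) + ‖d‖ ^ 2 / 4 := by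
    have i1 := real_inner_le_norm (gradient F x - gradient F y) d
    have i2 := mul_le_mul_of_nonneg_right h3 (norm_nonneg d)
    have i3 := mul_le_mul_of_nonneg_left (i1.trans i2) ha.le
    nlinarith [sq_nonneg (a * (ρ * ‖x - y‖) - ‖d‖ / 2)]
  have y2 : -(a * ⟪g - gradient F y, d⟫_ℝ)
      ≤ a ^ 2 * ‖g - gradient F y‖ ^ 2 + ‖d‖ ^ 2 / 4 := by
    have i1 := neg_le_of_abs_le (abs_real_inner_le_norm (g - gradient F y) d)
    have i3 := mul_le_mul_of_nonneg_left i1 ha.le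
    nlinarith [sq_nonneg (a * ‖g - gradient F y‖ - ‖d‖ / 2)]
  have y3 : b * ⟪x - xprev, d⟫_ℝ ≤ b / 2 * (‖d‖ ^ 2 + ‖x - xprev‖ ^ 2) := by
    have i1 := mul_le_mul_of_nonneg_left (real_inner_le_norm (x - xprev) d) hb
    nlinarith [mul_nonneg hb (sq_nonneg (‖x - xprev‖ - ‖d‖))]
  have s2 : a * ⟪gradient F x, d⟫_ℝ - a * ⟪g, d⟫_ℝ
      = a * ⟪gradient F x - gradient F y, d⟫_ℝ - a * ⟪g - gradient F y, d⟫_ℝ := by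
    rw [← mul_sub, s1, mul_sub]
  nlinarith

/-- The next iterate up to noise, relative to the proximal point `p` of `x`. -/
noncomputable def drift (F : Vec n → ℝ) (ρbar a b : ℝ) (x xprev y p : Vec n) : Vec n :=
  (1 - a * ρbar) • (x - p) - a • (gradient F y - gradient F p) + b • (x - xprev)

/-- Optimality makes `p` the proximal point for `a * r` of `p + (a * ρbar) • (x - p) - a • gradient
F p`. The vector on the right is the difference between the input of the step and this one, so the
bound is nonexpansiveness, proved by adding the two variational inequalities. -/
theorem IsProx.norm_sub_prox_le (hr : ProperClosedConvex r) (hF : SmoothIn ρ F (effDom r))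
    (ha : 0 < a) {x xprev xnext y g p : Vec n}
    (hp : IsProx a r (x - a • g + b • (x - xprev)) xnext)
    (hpx : IsProx (1 / ρbar) (objective F r) x p) (hpd : p ∈ effDom r) :
    ‖xnext - p‖ ≤ ‖drift F ρbar a b x xprev y p - a • (g - gradient F y)‖ := by
  have hn : xnext ∈ effDom r := hp.mem_effDom hpd
  have h1 := hp.variational hr p hpd
  have h2 := hpx.variational_objective hr (hF.differentiableAt p hpd) xnext hn
  rw [one_div_one_div] at h2
  set w := drift F ρbar a b x xprev y p - a • (g - gradient F y) with hw
  have hww : w = (x - a • g + b • (x - xprev)) - p - (a * ρbar) • (x - p) + a • gradient F p := by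
    rw [hw, drift]
    module
  have e : a * ⟪(1 / a) • (xnext - (x - a • g + b • (x - xprev))), p - xnext⟫_ℝ
      + a * ⟪gradient F p + ρbar • (p - x), xnext - p⟫_ℝ
      = ⟪w, xnext - p⟫_ℝ - ‖xnext - p‖ ^ 2 := by
    rw [hww, ← real_inner_self_eq_norm_sq, inner_smul_left, RCLike.conj_to_real, ← mul_assoc,
      mul_one_div_cancel ha.ne', one_mul, show p - xnext = -(xnext - p) by abel, inner_neg_right,
      show x - p = -(p - x) by abel, ← real_inner_smul_left, ← inner_neg_left, ← inner_add_left,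
      ← inner_sub_left]
    congr 1
    module
  have h3 : 0 ≤ ⟪w, xnext - p⟫_ℝ - ‖xnext - p‖ ^ 2 := by
    rw [← e, ← mul_add]
    exact mul_nonneg ha.le (by linarith)
  have h5 := real_inner_le_norm w (xnext - p)
  rcases (norm_nonneg (xnext - p)).eq_or_lt with h0 | h0
  · rw [← h0]; exact norm_nonneg _
  · refine le_of_mul_le_mul_right ?_ h0
    nlinarith

/-- Young's inequality spending three quarters of the contraction `s`. Scaling `p` and `q` by `s`
removes the fractions; the squares `t1`, `t2`, `t3` absorb the three cross terms. -/
theorem sq_add_add_le {s D p q : ℝ} (hs : 0 < s) (hs1 : s ≤ 1) :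
    ((1 - s) * D + p + q) ^ 2 ≤ (1 - s / 4) * D ^ 2 + (4 + 8 / s) * q ^ 2 + (1 + 1 / s) * p ^ 2 := by
  obtain ⟨p, rfl⟩ : ∃ p', p = s * p' := ⟨p / s, by field_simp⟩
  obtain ⟨q, rfl⟩ : ∃ q', q = s * q' := ⟨q / s, by field_simp⟩
  have e : (1 - s / 4) * D ^ 2 + (4 + 8 / s) * (s * q) ^ 2 + (1 + 1 / s) * (s * p) ^ 2
      = (1 - s / 4) * D ^ 2 + (4 * s ^ 2 + 8 * s) * q ^ 2 + (s ^ 2 + s) * p ^ 2 := by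
    field_simp
  have h1 : 0 ≤ 1 - s := by linarith
  have t1 : 0 ≤ (1 - s) * s * (5 / 4 * (D - 4 / 5 * p) ^ 2) := by positivity
  have t2 : 0 ≤ (1 - s) * s * (1 / 2 * (D - 2 * q) ^ 2) := by positivity
  have t3 : 0 ≤ s * (1 / 5 * (p - 5 * s * q) ^ 2) := by positivity
  have t4 : 0 ≤ (1 - s) * s ^ 2 * q ^ 2 := by positivity
  have t5 : 0 ≤ s * q ^ 2 := by positivity
  have t6 : 0 ≤ s ^ 2 * D ^ 2 := by positivity
  have t7 : 0 ≤ s ^ 2 * p ^ 2 := by positivity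
  rw [e]
  linarith

/-- Inserting `gradient F x` separates the delay error from a gradient difference between `x` and
`p`. The latter costs `a * ρ`, against the gain `a * ρbar` of the quadratic pull. -/
theorem norm_drift_le (hF : SmoothIn ρ F (effDom r)) (ha : 0 < a) (hb : 0 ≤ b)
    (haρ : a * ρbar ≤ 1) {x xprev y p : Vec n} (hx : x ∈ effDom r) (hy : y ∈ effDom r)
    (hpd : p ∈ effDom r) :
    ‖drift F ρbar a b x xprev y p‖
      ≤ (1 - a * (ρbar - ρ)) * ‖x - p‖ + a * (ρ * ‖x - y‖) + b * ‖x - xprev‖ := by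
  have e : drift F ρbar a b x xprev y p = (1 - a * ρbar) • (x - p)
      - a • (gradient F x - gradient F p) + a • (gradient F x - gradient F y)
      + b • (x - xprev) := by
    rw [drift]; module
  rw [e]
  refine (norm_add_le _ _).trans (add_le_add ((norm_add_le _ _).trans (add_le_add
    ((norm_sub_le _ _).trans ?_) ?_)) ?_)
  · rw [norm_smul, norm_smul, Real.norm_of_nonneg ha.le, Real.norm_of_nonneg (by linarith)]
    have := mul_le_mul_of_nonneg_left (hF.lipschitz x hx p hpd) ha.le
    linarith
  · rw [norm_smul, Real.norm_of_nonneg ha.le]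
    exact mul_le_mul_of_nonneg_left (hF.lipschitz x hx y hy) ha.le
  · rw [norm_smul, Real.norm_of_nonneg hb]

/-- One step of the method decreases the Moreau envelope up to errors. -/
theorem IsProx.moreau_step (hr : ProperClosedConvex r) (hF : SmoothIn ρ F (effDom r))
    (hρ : 0 ≤ ρ) (hρbar : ρ < ρbar) (ha : 0 < a) (hb : 0 ≤ b) (haρ : a * ρbar ≤ 1)
    {x xprev xnext y g p pnext : Vec n} (hx : x ∈ effDom r) (hy : y ∈ effDom r)
    (hp : IsProx a r (x - a • g + b • (x - xprev)) xnext)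
    (hpx : IsProx (1 / ρbar) (objective F r) x p) (hpd : p ∈ effDom r)
    (hpn : IsProx (1 / ρbar) (objective F r) xnext pnext) (hpnd : pnext ∈ effDom r) :
    moreau (1 / ρbar) (objective F r) xnext ≤ moreau (1 / ρbar) (objective F r) x
      - a * (ρbar - ρ) * ρbar / 8 * ‖x - p‖ ^ 2
      + ρbar * (2 + 4 / (a * (ρbar - ρ))) * b ^ 2 * ‖x - xprev‖ ^ 2
      + ρbar * ρ ^ 2 / 2 * (a ^ 2 + a / (ρbar - ρ)) * ‖x - y‖ ^ 2
      + ρbar / 2 * a ^ 2 * ‖g - gradient F y‖ ^ 2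
      - ρbar * a * ⟪drift F ρbar a b x xprev y p, g - gradient F y⟫_ℝ := by
  have hpos : 0 < ρbar := hρ.trans_lt hρbar
  have hδ : 0 < ρbar - ρ := by linarith
  have h1 := moreau_le hr hpn hpnd hpd
  rw [moreau_eq hr hpx hpd]
  have h2 := hp.norm_sub_prox_le hr hF ha (y := y) hpx hpd
  have h3 := norm_drift_le (xprev := xprev) hF ha hb haρ hx hy hpd
  set u := drift F ρbar a b x xprev y p
  set e := g - gradient F y
  have h2' : ‖xnext - p‖ ^ 2 ≤ ‖u‖ ^ 2 - 2 * a * ⟪u, e⟫_ℝ + a ^ 2 * ‖e‖ ^ 2 := by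
    refine (pow_le_pow_left₀ (norm_nonneg _) h2 2).trans_eq ?_
    rw [norm_sub_sq_real, inner_smul_right, norm_smul, Real.norm_of_nonneg ha.le]
    ring
  have hs : 0 < a * (ρbar - ρ) := by positivity
  have hs1 : a * (ρbar - ρ) ≤ 1 := by nlinarith [mul_nonneg ha.le hρ]
  have h3' := (pow_le_pow_left₀ (norm_nonneg _) h3 2).trans (sq_add_add_le hs hs1)
  have e1 : (1 + 1 / (a * (ρbar - ρ))) * (a * (ρ * ‖x - y‖)) ^ 2
      = ρ ^ 2 * (a ^ 2 + a / (ρbar - ρ)) * ‖x - y‖ ^ 2 := by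
    field_simp
  have e2 : (4 + 8 / (a * (ρbar - ρ))) * (b * ‖x - xprev‖) ^ 2
      = 2 * ((2 + 4 / (a * (ρbar - ρ))) * b ^ 2 * ‖x - xprev‖ ^ 2) := by ring
  rw [e1, e2] at h3'
  rw [norm_sub_rev p xnext] at h1
  rw [norm_sub_rev p x]
  -- The factor `ρbar / 2` of the envelope turns the loss `s / 4`, with `s = a * (ρbar - ρ)`, into
  -- the coefficient with `1 / 8`.
  have h4 := mul_le_mul_of_nonneg_left (h2'.trans (add_le_add_left (sub_le_sub_right h3' _) _))
    (half_pos hpos).le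
  nlinarith

/-- A delayed difference telescopes into at most `τ` steps, so Cauchy–Schwarz costs one factor `τ`;
the other appears because each step is counted by at most `τ` indices `k`. -/
theorem sum_norm_sub_delay_sq_le {x : ℕ → Vec n} (h01 : x 0 = x 1) {K τ : ℕ} {t : ℕ → ℕ}
    (ht : ∀ k ∈ Finset.Icc 1 K, t k ≤ τ) :
    ∑ k ∈ Finset.Icc 1 K, ‖x k - x (k - t k)‖ ^ 2
      ≤ (τ : ℝ) ^ 2 * ∑ k ∈ Finset.Icc 1 K, ‖x (k + 1) - x k‖ ^ 2 := by
  set d : ℕ → ℝ := fun j => ‖x (j + 1) - x j‖ with hd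
  have hk : ∀ k ∈ Finset.Icc 1 K, ‖x k - x (k - t k)‖ ^ 2
      ≤ τ * ∑ j ∈ Finset.Ico (k - τ) k, d j ^ 2 := by
    intro k hk
    have hle : ‖x k - x (k - t k)‖ ≤ ∑ j ∈ Finset.Ico (k - τ) k, d j := by
      rw [← Finset.sum_Ico_sub x (Nat.sub_le k (t k))]
      refine (norm_sum_le _ _).trans
        (Finset.sum_le_sum_of_subset_of_nonneg ?_ fun _ _ _ => norm_nonneg _)
      exact Finset.Ico_subset_Ico (Nat.sub_le_sub_left (ht k hk) k) le_rfl
    refine (pow_le_pow_left₀ (norm_nonneg _) hle 2).trans (sq_sum_le_card_mul_sum_sq.trans ?_)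
    refine mul_le_mul_of_nonneg_right ?_ (Finset.sum_nonneg fun _ _ => sq_nonneg _)
    rw [Nat.card_Ico]
    exact_mod_cast (by omega : k - (k - τ) ≤ τ)
  -- Windows may reach index `0`; that step vanishes because the two starting points coincide, so
  -- the final sum can begin at `1`.
  have hd0 : d 0 = 0 := by simp [hd, h01]
  calc ∑ k ∈ Finset.Icc 1 K, ‖x k - x (k - t k)‖ ^ 2
      ≤ ∑ k ∈ Finset.Icc 1 K, τ * ∑ j ∈ Finset.Ico (k - τ) k, d j ^ 2 := Finset.sum_le_sum hk
    _ = τ * ∑ j ∈ Finset.range K,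
          ∑ k ∈ (Finset.Icc 1 K).filter (fun k => j ∈ Finset.Ico (k - τ) k), d j ^ 2 := by
        rw [← Finset.mul_sum]
        congr 1
        refine Finset.sum_comm' fun k j => ?_
        simp only [Finset.mem_Icc, Finset.mem_Ico, Finset.mem_filter, Finset.mem_range]
        omega
    _ ≤ τ * ∑ j ∈ Finset.range K, τ * d j ^ 2 := by
        refine mul_le_mul_of_nonneg_left (Finset.sum_le_sum fun j _ => ?_) (Nat.cast_nonneg τ)
        rw [Finset.sum_const, nsmul_eq_mul]
        refine mul_le_mul_of_nonneg_right ?_ (sq_nonneg _)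
        have hsub : (Finset.Icc 1 K).filter (fun k => j ∈ Finset.Ico (k - τ) k)
            ⊆ Finset.Ioc j (j + τ) := by
          intro k
          simp only [Finset.mem_Icc, Finset.mem_Ico, Finset.mem_filter, Finset.mem_Ioc]
          omega
        have := Finset.card_le_card hsub
        rw [Nat.card_Ioc, Nat.add_sub_cancel_left] at this
        exact_mod_cast this
    _ = (τ : ℝ) ^ 2 * ∑ j ∈ Finset.range K, d j ^ 2 := by
        rw [← Finset.mul_sum]; ring
    _ ≤ (τ : ℝ) ^ 2 * ∑ k ∈ Finset.Icc 1 K, d k ^ 2 := by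
        refine mul_le_mul_of_nonneg_left ?_ (sq_nonneg _)
        rw [← Finset.sum_subset (s₁ := (Finset.range K).erase 0) (Finset.erase_subset _ _)]
        · refine Finset.sum_le_sum_of_subset_of_nonneg ?_ fun _ _ _ => sq_nonneg _
          intro k
          simp only [Finset.mem_erase, Finset.mem_range, Finset.mem_Icc]
          omega
        · intro k h1 h2
          have : k = 0 := by
            by_contra h
            exact h2 (Finset.mem_erase.2 ⟨h, h1⟩)
          simp [this, hd0]

theorem sum_norm_sub_prev_sq_le {x : ℕ → Vec n} (h01 : x 0 = x 1) (K : ℕ) :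
    ∑ k ∈ Finset.Icc 1 K, ‖x k - x (k - 1)‖ ^ 2
      ≤ ∑ k ∈ Finset.Icc 1 K, ‖x (k + 1) - x k‖ ^ 2 := by
  simpa using sum_norm_sub_delay_sq_le h01 (K := K) (τ := 1) (t := fun _ => 1) (by simp)

variable {x g : ℕ → Vec n} {t : ℕ → ℕ} {K τ : ℕ}

theorem path_mem_effDom (h01 : x 0 = x 1) (h1 : x 1 ∈ effDom r)
    (hstep : ∀ k ∈ Finset.Icc 1 K,
      IsProx a r (x k - a • g k + b • (x k - x (k - 1))) (x (k + 1))) :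
    ∀ k ≤ K + 1, x k ∈ effDom r := by
  intro k hk
  match k with
  | 0 => rwa [h01]
  | 1 => exact h1
  | k + 2 => exact (hstep (k + 1) (Finset.mem_Icc.2 ⟨by omega, by omega⟩)).mem_effDom h1

/-- The objective telescopes and its last value is at least the optimum. The delay and inertia
errors are multiples of the sum on the left and are moved there. -/
theorem sum_norm_sub_sq_le (hr : ProperClosedConvex r) (hF : SmoothIn ρ F (effDom r))
    (hbd : (⨅ x, objective F r x) ≠ ⊥) (ha : 0 < a) (hb : 0 ≤ b)
    (h01 : x 0 = x 1) (h1 : x 1 ∈ effDom r)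
    (hstep : ∀ k ∈ Finset.Icc 1 K,
      IsProx a r (x k - a • g k + b • (x k - x (k - 1))) (x (k + 1)))
    (ht : ∀ k ∈ Finset.Icc 1 K, t k ≤ τ) :
    (1 / 2 - a * ρ / 2 - τ ^ 2 * a ^ 2 * ρ ^ 2 - b)
        * ∑ k ∈ Finset.Icc 1 K, ‖x (k + 1) - x k‖ ^ 2
      ≤ a * ((objective F r (x 1)).toReal - optVal (objective F r))
        + a ^ 2 * ∑ k ∈ Finset.Icc 1 K, ‖g k - gradient F (x (k - t k))‖ ^ 2 := by
  have hmem := path_mem_effDom h01 h1 hstep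
  have hS := Finset.sum_le_sum fun k hk => (hstep k hk).objective_step hr hF ha hb
    (hmem k (by simp at hk; omega)) (hmem (k - t k) (by simp at hk; omega))
  simp only [Finset.sum_add_distrib, ← Finset.mul_sum] at hS
  have htel : ∑ k ∈ Finset.Icc 1 K, ((F (x (k + 1)) + (r (x (k + 1))).toReal)
      - (F (x k) + (r (x k)).toReal))
      = (F (x (K + 1)) + (r (x (K + 1))).toReal) - (F (x 1) + (r (x 1)).toReal) := by
    rw [← Finset.Ico_add_one_right_eq_Icc]
    exact Finset.sum_Ico_sub (fun k => F (x k) + (r (x k)).toReal) (by omega)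
  rw [htel] at hS
  have hd := sum_norm_sub_delay_sq_le h01 ht
  have hp := sum_norm_sub_prev_sq_le h01 K
  have hopt := hr.optVal_le hbd (hmem (K + 1) le_rfl)
  rw [hr.toReal_objective h1]
  have hd' := mul_le_mul_of_nonneg_left hd (by positivity : 0 ≤ a ^ 2 * ρ ^ 2)
  have hp' := mul_le_mul_of_nonneg_left hp (by positivity : 0 ≤ b / 2)
  have hopt' := mul_le_mul_of_nonneg_left hopt ha.le
  nlinarith

/-- Telescopes the envelope, which is bounded below by the optimum. The inner product with the noise
is kept exact, because only its mean vanishes. -/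
theorem sum_norm_sub_prox_sq_le (hr : ProperClosedConvex r) (hF : SmoothIn ρ F (effDom r))
    (hbd : (⨅ x, objective F r x) ≠ ⊥) (hρ : 0 ≤ ρ) (hρbar : ρ < ρbar) (ha : 0 < a) (hb : 0 ≤ b)
    (haρ : a * ρbar ≤ 1) (h01 : x 0 = x 1) (h1 : x 1 ∈ effDom r)
    (hstep : ∀ k ∈ Finset.Icc 1 K,
      IsProx a r (x k - a • g k + b • (x k - x (k - 1))) (x (k + 1)))
    (ht : ∀ k ∈ Finset.Icc 1 K, t k ≤ τ) {p : Vec n → Vec n}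
    (hp : ∀ x, IsProx (1 / ρbar) (objective F r) x (p x)) (hpd : ∀ x, p x ∈ effDom r) :
    a * (ρbar - ρ) * ρbar / 8 * ∑ k ∈ Finset.Icc 1 K, ‖x k - p (x k)‖ ^ 2
      ≤ moreau (1 / ρbar) (objective F r) (x 1) - optVal (objective F r)
        + (ρbar * (2 + 4 / (a * (ρbar - ρ))) * b ^ 2
            + τ ^ 2 * ρbar * ρ ^ 2 / 2 * (a ^ 2 + a / (ρbar - ρ)))
          * ∑ k ∈ Finset.Icc 1 K, ‖x (k + 1) - x k‖ ^ 2
        + ρbar / 2 * a ^ 2 * ∑ k ∈ Finset.Icc 1 K, ‖g k - gradient F (x (k - t k))‖ ^ 2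
        - ρbar * a * ∑ k ∈ Finset.Icc 1 K,
          ⟪drift F ρbar a b (x k) (x (k - 1)) (x (k - t k)) (p (x k)),
            g k - gradient F (x (k - t k))⟫_ℝ := by
  have hpos : 0 < ρbar := hρ.trans_lt hρbar
  have hδ : 0 < ρbar - ρ := by linarith
  have hmem := path_mem_effDom h01 h1 hstep
  set ψ := moreau (1 / ρbar) (objective F r)
  have hS := Finset.sum_le_sum fun k hk => (hstep k hk).moreau_step hr hF hρ hρbar ha hb haρ
    (hmem k (by simp at hk; omega)) (hmem (k - t k) (by simp at hk; omega))
    (hp _) (hpd _) (hp _) (hpd _)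
  simp only [Finset.sum_add_distrib, Finset.sum_sub_distrib, ← Finset.mul_sum] at hS
  have htel : ∑ k ∈ Finset.Icc 1 K, (ψ (x (k + 1)) - ψ (x k)) = ψ (x (K + 1)) - ψ (x 1) := by
    rw [← Finset.Ico_add_one_right_eq_Icc]
    exact Finset.sum_Ico_sub (fun k => ψ (x k)) (by omega)
  rw [Finset.sum_sub_distrib] at htel
  have hd := sum_norm_sub_delay_sq_le h01 ht
  have hpr := sum_norm_sub_prev_sq_le h01 K
  have hopt : optVal (objective F r) ≤ ψ (x (K + 1)) := by
    have h2 := hr.optVal_le hbd (hpd (x (K + 1)))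
    have h3 := moreau_eq hr (hp (x (K + 1))) (hpd (x (K + 1)))
    have : 0 ≤ ρbar / 2 * ‖p (x (K + 1)) - x (K + 1)‖ ^ 2 := by positivity
    linarith
  have hd' := mul_le_mul_of_nonneg_left hd
    (by positivity : 0 ≤ ρbar * ρ ^ 2 / 2 * (a ^ 2 + a / (ρbar - ρ)))
  have hp' := mul_le_mul_of_nonneg_left hpr
    (by positivity : 0 ≤ ρbar * (2 + 4 / (a * (ρbar - ρ))) * b ^ 2)
  linarith

end Path

/-! ### Fresh samples, adaptedness and the random index. -/

section Sampling

variable {n : ℕ} {Ω Ξ : Type*} {m mΩ : MeasurableSpace Ω} [MeasurableSpace Ξ]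
  {P : Measure Ω} {D : Measure Ξ}

/-- Freshness as a product law: Fubini then plays the role of conditional expectation. -/
theorem map_prodMk_eq_prod_of_indep [IsProbabilityMeasure P] {β : Type*} [MeasurableSpace β]
    (hm : m ≤ mΩ) {X : Ω → β} (hX : Measurable[m] X) {ξ : Ω → Ξ} (hξ : Measurable ξ)
    (hlaw : P.map ξ = D) (hind : Indep (MeasurableSpace.comap ξ inferInstance) m P) :
    P.map (fun ω => (X ω, ξ ω)) = (P.map X).prod D := by
  have h : IndepFun X ξ P := by
    rw [IndepFun_iff_Indep]
    exact indep_of_indep_of_le_left hind.symm hX.comap_le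
  rw [(indepFun_iff_map_prod_eq_prod_map_map (hX.mono hm le_rfl).aemeasurable
    hξ.aemeasurable).1 h, hlaw]

theorem lintegral_fresh_sample [IsProbabilityMeasure P] [IsProbabilityMeasure D]
    {β : Type*} [MeasurableSpace β]
    (hm : m ≤ mΩ) {X : Ω → β} (hX : Measurable[m] X) {ξ : Ω → Ξ} (hξ : Measurable ξ)
    (hlaw : P.map ξ = D) (hind : Indep (MeasurableSpace.comap ξ inferInstance) m P)
    {H : β × Ξ → ENNReal} (hH : Measurable H) :
    ∫⁻ ω, H (X ω, ξ ω) ∂P = ∫⁻ ω, ∫⁻ s, H (X ω, s) ∂D ∂P := by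
  have hX' : Measurable X := hX.mono hm le_rfl
  rw [← lintegral_map (f := H) hH (hX'.prodMk hξ), map_prodMk_eq_prod_of_indep hm hX hξ hlaw hind,
    lintegral_prod _ hH.aemeasurable, lintegral_map hH.lintegral_prod_right' hX']

theorem integral_fresh_sample [IsProbabilityMeasure P] [IsProbabilityMeasure D]
    {β : Type*} [MeasurableSpace β]
    (hm : m ≤ mΩ) {X : Ω → β} (hX : Measurable[m] X) {ξ : Ω → Ξ} (hξ : Measurable ξ)
    (hlaw : P.map ξ = D) (hind : Indep (MeasurableSpace.comap ξ inferInstance) m P)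
    {H : β × Ξ → ℝ} (hH : Measurable H) (hint : Integrable (fun ω => H (X ω, ξ ω)) P) :
    ∫ ω, H (X ω, ξ ω) ∂P = ∫ ω, ∫ s, H (X ω, s) ∂D ∂P := by
  have hX' : Measurable X := hX.mono hm le_rfl
  have hmap := map_prodMk_eq_prod_of_indep hm hX hξ hlaw hind
  have hint' : Integrable H ((P.map X).prod D) := by
    rw [← hmap]
    exact (integrable_map_measure hH.aestronglyMeasurable (hX'.prodMk hξ).aemeasurable).2 hint
  rw [← integral_map (f := H) (hX'.prodMk hξ).aemeasurable hH.aestronglyMeasurable, hmap,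
    integral_prod _ hint', integral_map hX'.aemeasurable]
  exact hH.stronglyMeasurable.integral_prod_right'.aestronglyMeasurable

theorem memLp_two_of_lintegral_le {α : Type*} [MeasurableSpace α] {μ : Measure α}
    {X : α → Vec n} (hX : AEStronglyMeasurable X μ) {c : ℝ} (hc : 0 ≤ c)
    (h : ∫⁻ s, ENNReal.ofReal (‖X s‖ ^ 2) ∂μ ≤ ENNReal.ofReal c) :
    MemLp X 2 μ ∧ ∫ s, ‖X s‖ ^ 2 ∂μ ≤ c := by
  have hsq : AEStronglyMeasurable (fun s => ‖X s‖ ^ 2) μ := hX.norm.pow 2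
  have hnn : 0 ≤ᵐ[μ] fun s => ‖X s‖ ^ 2 := Eventually.of_forall fun s => sq_nonneg _
  refine ⟨(memLp_two_iff_integrable_sq_norm hX).2 ⟨hsq, ?_⟩, ?_⟩
  · rw [hasFiniteIntegral_iff_ofReal hnn]
    exact h.trans_lt ENNReal.ofReal_lt_top
  · rw [integral_eq_lintegral_of_nonneg_ae hnn hsq]
    exact ENNReal.toReal_le_of_le_ofReal hc h

/-- The noise of a fresh sample has second moment at most `σ²`. -/
theorem memLp_noise [IsProbabilityMeasure P] [IsProbabilityMeasure D] (hm : m ≤ mΩ) {Y : Ω → Vec n}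
    (hY : Measurable[m] Y) {ξ : Ω → Ξ} (hξ : Measurable ξ) (hlaw : P.map ξ = D)
    (hind : Indep (MeasurableSpace.comap ξ inferInstance) m P)
    {G : Vec n → Ξ → Vec n} (hG : Measurable fun p : Vec n × Ξ => G p.1 p.2)
    {V : Vec n → Vec n} (hV : Measurable V) {σ : ℝ}
    (hvar : ∀ ω, ∫⁻ s, ENNReal.ofReal (‖G (Y ω) s - V (Y ω)‖ ^ 2) ∂D ≤ ENNReal.ofReal (σ ^ 2)) :
    MemLp (fun ω => G (Y ω) (ξ ω) - V (Y ω)) 2 P ∧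
      ∫ ω, ‖G (Y ω) (ξ ω) - V (Y ω)‖ ^ 2 ∂P ≤ σ ^ 2 := by
  have hY' : Measurable Y := hY.mono hm le_rfl
  have hdiff : Measurable fun p : Vec n × Ξ => G p.1 p.2 - V p.1 := hG.sub (hV.comp measurable_fst)
  refine memLp_two_of_lintegral_le (hdiff.comp (hY'.prodMk hξ)).aestronglyMeasurable
    (sq_nonneg σ) ?_
  refine (lintegral_fresh_sample hm hY hξ hlaw hind
    (H := fun p => ENNReal.ofReal (‖G p.1 p.2 - V p.1‖ ^ 2))
    (hdiff.norm.pow_const 2).ennreal_ofReal).trans_le ((lintegral_mono hvar).trans ?_)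
  simp

/-- The noise of a fresh sample is orthogonal to the past. -/
theorem integral_inner_noise_eq_zero [IsProbabilityMeasure P] [IsProbabilityMeasure D]
    (hm : m ≤ mΩ) {Y u : Ω → Vec n}
    (hY : Measurable[m] Y) (hu : Measurable[m] u) {ξ : Ω → Ξ} (hξ : Measurable ξ)
    (hlaw : P.map ξ = D) (hind : Indep (MeasurableSpace.comap ξ inferInstance) m P)
    {G : Vec n → Ξ → Vec n} (hG : Measurable fun p : Vec n × Ξ => G p.1 p.2)
    {V : Vec n → Vec n} (hV : Measurable V) {σ : ℝ}
    (hvar : ∀ ω, ∫⁻ s, ENNReal.ofReal (‖G (Y ω) s - V (Y ω)‖ ^ 2) ∂D ≤ ENNReal.ofReal (σ ^ 2))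
    (hunb : ∀ᵐ ω ∂P, ∫ s, G (Y ω) s ∂D = V (Y ω))
    (hint : Integrable (fun ω => ⟪u ω, G (Y ω) (ξ ω) - V (Y ω)⟫_ℝ) P) :
    ∫ ω, ⟪u ω, G (Y ω) (ξ ω) - V (Y ω)⟫_ℝ ∂P = 0 := by
  have hH : Measurable fun p : (Vec n × Vec n) × Ξ => ⟪p.1.1, G p.1.2 p.2 - V p.1.2⟫_ℝ := by
    have h1 : Measurable fun p : (Vec n × Vec n) × Ξ => G p.1.2 p.2 :=
      hG.comp ((measurable_snd.comp measurable_fst).prodMk measurable_snd)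
    exact (measurable_fst.comp measurable_fst).inner
      (h1.sub (hV.comp (measurable_snd.comp measurable_fst)))
  have key := integral_fresh_sample hm (hu.prodMk hY) hξ hlaw hind hH hint
  refine key.trans (integral_eq_zero_of_ae ?_)
  filter_upwards [hunb] with ω hω
  have hmeas : Measurable fun s => G (Y ω) s - V (Y ω) :=
    (hG.comp measurable_prodMk_left).sub_const _
  -- The variance bound makes the sample gradient integrable, so unbiasedness can be used by
  -- splitting the integral.
  have hi : Integrable (fun s => G (Y ω) s - V (Y ω)) D :=
    (memLp_two_of_lintegral_le hmeas.aestronglyMeasurable (sq_nonneg σ) (hvar ω)).1.integrable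
      one_le_two
  have hi' : Integrable (fun s => G (Y ω) s) D := by
    have h := hi.add (integrable_const (V (Y ω)))
    simpa only [Pi.add_def, sub_add_cancel] using h
  change ∫ s, ⟪u ω, G (Y ω) s - V (Y ω)⟫_ℝ ∂D = 0
  rw [integral_inner hi, integral_sub hi' (integrable_const _), hω]
  simp

/-- Used for measurability of the iterates. The proximal map is nonexpansive where it is defined,
hence extends to a Lipschitz map on the whole space. -/
theorem exists_continuous_eq_prox {r : Vec n → EReal} (hr : ProperClosedConvex r) {a : ℝ}
    (ha : 0 < a) : ∃ q : Vec n → Vec n, Continuous q ∧ ∀ z p, IsProx a r z p → q z = p := by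
  classical
  let q₀ : Vec n → Vec n := fun z => if h : ∃ p, IsProx a r z p then h.choose else 0
  have hq₀ : ∀ z, (∃ p, IsProx a r z p) → IsProx a r z (q₀ z) := by
    intro z hz
    simp only [q₀, dif_pos hz]
    exact hz.choose_spec
  have hL : LipschitzOnWith 1 q₀ {z | ∃ p, IsProx a r z p} := by
    refine LipschitzOnWith.of_dist_le_mul fun z hz z' hz' => ?_
    rw [dist_eq_norm, dist_eq_norm, NNReal.coe_one, one_mul]
    exact (hq₀ z hz).norm_sub_le hr ha (hq₀ z' hz')
  obtain ⟨q, hq, heq⟩ := hL.extend_finite_dimension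
  refine ⟨q, hq.continuous, fun z p hp => ?_⟩
  rw [← heq (show z ∈ {z | ∃ p, IsProx a r z p} from ⟨p, hp⟩)]
  have h := (hq₀ z ⟨p, hp⟩).norm_sub_le hr ha hp
  rw [sub_self, norm_zero] at h
  exact sub_eq_zero.1 (norm_le_zero_iff.1 h)

/-- Off `S` the gradient of `F` has no known regularity. The extension is measurable and preserves
square integrability, and the run only evaluates it on the domain. -/
theorem SmoothIn.exists_lipschitzWith_eq_gradient {F : Vec n → ℝ} {ρ : ℝ} {S : Set (Vec n)}
    (hF : SmoothIn ρ F S) :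
    ∃ (L : NNReal) (V : Vec n → Vec n), LipschitzWith L V ∧ ∀ y ∈ S, V y = gradient F y := by
  have hL : LipschitzOnWith ρ.toNNReal (gradient F) S := by
    refine LipschitzOnWith.of_dist_le_mul fun z hz z' hz' => ?_
    rw [dist_eq_norm, dist_eq_norm]
    exact (hF.lipschitz z hz z' hz').trans
      (mul_le_mul_of_nonneg_right (Real.le_coe_toNNReal ρ) (norm_nonneg _))
  obtain ⟨V, hV, heq⟩ := hL.extend_finite_dimension
  exact ⟨_, V, hV, fun y hy => (heq hy).symm⟩

theorem measurable_delayed {m : MeasurableSpace Ω} {x : ℕ → Ω → Vec n} {k : ℕ} {t : Ω → ℕ}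
    (hx : ∀ j ≤ k, Measurable (x j)) (ht : Measurable t) :
    Measurable fun ω => x (k - t ω) ω := by
  have h : Measurable fun p : ℕ × Ω => x (k - p.1) p.2 :=
    measurable_from_prod_countable_right fun j => hx (k - j) (Nat.sub_le k j)
  exact h.comp (ht.prodMk measurable_id)

theorem measurable_inertial_step {m : MeasurableSpace Ω} {G : Vec n → Ξ → Vec n}
    (hG : Measurable fun p : Vec n × Ξ => G p.1 p.2) {q : Vec n → Vec n} (hq : Measurable q)
    {X Xprev Y : Ω → Vec n} {ζ : Ω → Ξ} (hX : Measurable X) (hXprev : Measurable Xprev)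
    (hY : Measurable Y) (hζ : Measurable ζ) (a b : ℝ) :
    Measurable fun ω => q (X ω - a • G (Y ω) (ζ ω) + b • (X ω - Xprev ω)) := by
  have hg : Measurable fun ω => G (Y ω) (ζ ω) := hG.comp (hY.prodMk hζ)
  exact hq.comp ((hX.sub (hg.const_smul a)).add ((hX.sub hXprev).const_smul b))

/-- The iterates are adapted to the history. -/
theorem IsInertialRun.measurable {f : Vec n → Ξ → ℝ}
    (hf : Measurable fun p : Vec n × Ξ => sampleGrad f p.1 p.2) {r : Vec n → EReal}
    (hr : ProperClosedConvex r) {a b : ℕ → ℝ} {K : ℕ} (ha : ∀ k ∈ Finset.Icc 1 K, 0 < a k)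
    {ℱ : Filtration ℕ mΩ} {ξ : ℕ → Ω → Ξ} {delay : ℕ → Ω → ℕ}
    (hs : IsSampling P D ℱ ξ delay K) {x₀ : Vec n} {x : ℕ → Ω → Vec n}
    (hrun : IsInertialRun f r a b ξ delay K x₀ x) :
    ∀ k ≤ K + 1, Measurable[ℱ k] (x k) := by
  intro k
  induction k using Nat.strong_induction_on with
  | _ k ih =>
    intro hk
    match k, ih, hk with
    | 0, _, _ =>
      rw [show x 0 = fun _ => x₀ from funext hrun.init_zero]
      exact measurable_const
    | 1, _, _ =>
      rw [show x 1 = fun _ => x₀ from funext hrun.init_one]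
      exact measurable_const
    | k + 2, ih, hk =>
      have hkK : k + 1 ∈ Finset.Icc 1 K := Finset.mem_Icc.2 ⟨by omega, by omega⟩
      obtain ⟨q, hq, hqp⟩ := exists_continuous_eq_prox hr (ha _ hkK)
      have e : x (k + 2) = fun ω => q (x (k + 1) ω
          - a (k + 1) • sampleGrad f (x (k + 1 - delay (k + 1) ω) ω) (ξ (k + 1) ω)
          + b (k + 1) • (x (k + 1) ω - x k ω)) :=
        funext fun ω => (hqp _ _ (hrun.step (k + 1) hkK ω)).symm
      have hx : ∀ j ≤ k + 1, Measurable[ℱ (k + 2)] (x j) := fun j hj =>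
        (ih j (by omega) (by omega)).mono (ℱ.mono (by omega)) le_rfl
      have hd : Measurable[ℱ (k + 2)] (delay (k + 1)) :=
        (hs.delay_meas _ hkK).mono (ℱ.mono (by omega)) le_rfl
      have hξ : Measurable[ℱ (k + 2)] (ξ (k + 1)) := hs.sample_meas _ hkK
      have hY := measurable_delayed hx hd
      rw [e]
      exact measurable_inertial_step (m := ℱ (k + 2)) hf hq.measurable (hx _ le_rfl)
        (hx k (by omega)) hY hξ _ _

theorem memLp_two_comp_of_lipschitzWith [IsProbabilityMeasure P] {q : Vec n → Vec n} {L : NNReal} (hq : LipschitzWith L q)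
    {X : Ω → Vec n} (hX : MemLp X 2 P) : MemLp (fun ω => q (X ω)) 2 P := by
  have h : LipschitzWith L fun y => q y - q 0 := by
    refine LipschitzWith.of_dist_le_mul fun y z => ?_
    simpa using hq.dist_le_mul y z
  have h1 : MemLp ((fun y => q y - q 0) ∘ X) 2 P := h.comp_memLp (by simp) hX
  have h2 := h1.add (memLp_const (q 0))
  simpa only [Function.comp_def, Pi.add_def, sub_add_cancel] using h2

/-- The random index takes finitely many values, so the sum of all the norms dominates. -/
theorem memLp_two_delayed {x : ℕ → Ω → Vec n} {k : ℕ} {t : Ω → ℕ}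
    (hx : ∀ j ≤ k, MemLp (x j) 2 P) (hm : AEStronglyMeasurable (fun ω => x (k - t ω) ω) P) :
    MemLp (fun ω => x (k - t ω) ω) 2 P := by
  have h : MemLp (fun ω => ∑ j ∈ Finset.range (k + 1), ‖x j ω‖) 2 P :=
    memLp_finsetSum _ fun j hj => (hx j (by simp at hj; omega)).norm
  refine h.mono hm (Eventually.of_forall fun ω => ?_)
  refine le_trans ?_ (le_abs_self _)
  exact Finset.single_le_sum (f := fun j => ‖x j ω‖) (fun _ _ => norm_nonneg _)
    (Finset.mem_range.2 (by omega))

/-- The prescribed weights add up to one, so `T` lies in the range almost surely. Splitting over `T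
= k` and independence factor each expectation. -/
theorem IsRandomIndex.integral_comp [IsProbabilityMeasure P] {a : ℕ → ℝ} {K : ℕ} {x : ℕ → Ω → Vec n} {T : Ω → ℕ}
    (hT : IsRandomIndex P a K x T) (ha : ∑ j ∈ Finset.Icc 1 K, a j ≠ 0) {q : Vec n → ℝ}
    (hq : Measurable q)
    (hint : ∀ k ∈ Finset.Icc 1 K, Integrable (fun ω => q (x k ω)) P) :
    Integrable (fun ω => q (x (T ω) ω)) P ∧
      ∫ ω, q (x (T ω) ω) ∂P
        = ∑ k ∈ Finset.Icc 1 K, a k / (∑ j ∈ Finset.Icc 1 K, a j) * ∫ ω, q (x k ω) ∂P := by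
  have hmeas : ∀ k, MeasurableSet (T ⁻¹' {k}) := fun k => hT.measurable (measurableSet_singleton k)
  have hmem : ∀ᵐ ω ∂P, T ω ∈ Finset.Icc 1 K := by
    have h1 : P.real (T ⁻¹' ↑(Finset.Icc 1 K)) = 1 := by
      rw [← sum_measureReal_preimage_singleton _ fun k _ => hmeas k]
      rw [Finset.sum_congr rfl fun k hk => (show P.real (T ⁻¹' {k}) = _ from hT.law k hk),
        ← Finset.sum_div, div_self ha]
    have h2 : P (T ⁻¹' ↑(Finset.Icc 1 K)) = 1 := by
      rwa [measureReal_def, ENNReal.toReal_eq_one_iff] at h1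
    exact (mem_ae_iff_prob_eq_one (hT.measurable (Finset.measurableSet _))).2 h2
  have hae : (fun ω => q (x (T ω) ω)) =ᵐ[P] fun ω => ∑ k ∈ Finset.Icc 1 K,
      (T ⁻¹' {k}).indicator (fun _ => (1 : ℝ)) ω * q (x k ω) := by
    filter_upwards [hmem] with ω hω
    rw [Finset.sum_eq_single_of_mem (T ω) hω]
    · simp
    · intro k _ hk
      simp [Set.indicator, hk.symm]
  have hterm : ∀ k ∈ Finset.Icc 1 K, Integrable (fun ω =>
      (T ⁻¹' {k}).indicator (fun _ => (1 : ℝ)) ω * q (x k ω)) P := by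
    intro k hk
    have : (fun ω => (T ⁻¹' {k}).indicator (fun _ => (1 : ℝ)) ω * q (x k ω))
        = (T ⁻¹' {k}).indicator (fun ω => q (x k ω)) := by
      funext ω
      by_cases h : ω ∈ T ⁻¹' {k} <;> simp [h]
    rw [this]
    exact (hint k hk).indicator (hmeas k)
  refine ⟨(integrable_finsetSum _ hterm).congr hae.symm, ?_⟩
  rw [integral_congr_ae hae, integral_finsetSum _ hterm]
  refine Finset.sum_congr rfl fun k hk => ?_
  have hkK : k < K + 1 := by simp at hk; omega
  have hind : IndepFun (fun ω => (T ⁻¹' {k}).indicator (fun _ => (1 : ℝ)) ω)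
      (fun ω => q (x k ω)) P :=
    hT.indep.comp (φ := ({k} : Set ℕ).indicator fun _ => (1 : ℝ))
      (ψ := fun y : Fin (K + 1) → Vec n => q (y ⟨k, hkK⟩))
      (measurable_const.indicator (measurableSet_singleton k))
      (hq.comp (measurable_pi_apply _))
  rw [hind.integral_fun_mul_eq_mul_integral
    (measurable_const.indicator (hmeas k)).aestronglyMeasurable (hint k hk).1,
    integral_indicator_const _ (hmeas k), smul_eq_mul, mul_one]
  congr 1
  exact hT.law k hk

end Sampling

/-! ### Passing to expectations. -/

section Expectation

variable {n : ℕ} {Ω Ξ : Type*} {mΩ : MeasurableSpace Ω} [MeasurableSpace Ξ]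
  {P : Measure Ω} [IsProbabilityMeasure P] {D : Measure Ξ} [IsProbabilityMeasure D]

theorem measurable_drift {Ω : Type*} {m : MeasurableSpace Ω} {X Xprev Y : Ω → Vec n}
    (hX : Measurable X) (hXprev : Measurable Xprev) (hY : Measurable Y) {p V : Vec n → Vec n}
    (hp : Measurable p) (hV : Measurable V) (a b c : ℝ) :
    Measurable fun ω => c • (X ω - p (X ω)) - a • (V (Y ω) - V (p (X ω)))
      + b • (X ω - Xprev ω) := by
  have h1 : Measurable fun ω => p (X ω) := hp.comp hX
  have h2 : Measurable fun ω => V (Y ω) := hV.comp hY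
  have h3 : Measurable fun ω => V (p (X ω)) := hV.comp h1
  exact (((hX.sub h1).const_smul c).sub ((h2.sub h3).const_smul a)).add
    ((hX.sub hXprev).const_smul b)

theorem memLp_two_drift {X Xprev Y : Ω → Vec n} (hX : MemLp X 2 P) (hXprev : MemLp Xprev 2 P)
    (hY : MemLp Y 2 P) {p V : Vec n → Vec n} {L L' : NNReal} (hp : LipschitzWith L p)
    (hV : LipschitzWith L' V) (a b c : ℝ) :
    MemLp (fun ω => c • (X ω - p (X ω)) - a • (V (Y ω) - V (p (X ω)))
      + b • (X ω - Xprev ω)) 2 P := by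
  have h1 : MemLp (fun ω => p (X ω)) 2 P := memLp_two_comp_of_lipschitzWith hp hX
  have h2 : MemLp (fun ω => V (Y ω)) 2 P := memLp_two_comp_of_lipschitzWith hV hY
  have h3 : MemLp (fun ω => V (p (X ω))) 2 P := memLp_two_comp_of_lipschitzWith hV h1
  have h4 : MemLp (fun ω => c • (X ω - p (X ω))) 2 P := (hX.sub h1).const_smul c
  have h5 : MemLp (fun ω => a • (V (Y ω) - V (p (X ω)))) 2 P := (h2.sub h3).const_smul a
  have h6 : MemLp (fun ω => b • (X ω - Xprev ω)) 2 P := (hX.sub hXprev).const_smul b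
  exact (h4.sub h5).add h6

/-- The expected sum of the squared distances of the iterates to their proximal points. -/
theorem IsInertialRun.sum_integral_norm_sub_prox_sq_le {r : Vec n → EReal}
    (hr : ProperClosedConvex r) {f : Vec n → Ξ → ℝ}
    (hf : Measurable fun p : Vec n × Ξ => sampleGrad f p.1 p.2) {F : Vec n → ℝ}
    (hFf : F = expLoss D f) (hbd : (⨅ x, objective F r x) ≠ ⊥) {ρ ρbar σ a b : ℝ}
    (hρ : 0 ≤ ρ) (hρbar : ρ < ρbar) (hF : SmoothIn ρ F (effDom r))
    (hvar : BoundedVariance D f σ (effDom r)) (ha : 0 < a) (hb : 0 ≤ b) (haρ : a * ρbar ≤ 1)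
    {K τ : ℕ} (hγ : 0 < 1 / 2 - a * ρ / 2 - τ ^ 2 * a ^ 2 * ρ ^ 2 - b)
    {ℱ : Filtration ℕ mΩ} {ξ : ℕ → Ω → Ξ} {delay : ℕ → Ω → ℕ}
    (hs : IsSampling P D ℱ ξ delay K) (hdelay : ∀ k ∈ Finset.Icc 1 K, ∀ ω, delay k ω ≤ τ)
    {x₀ : Vec n} {x : ℕ → Ω → Vec n}
    (hrun : IsInertialRun f r (fun _ => a) (fun _ => b) ξ delay K x₀ x)
    (hunb : UnbiasedAlong P D f delay K x) {p : Vec n → Vec n}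
    (hp : ∀ x, IsProx (1 / ρbar) (objective F r) x (p x)) (hpd : ∀ x, p x ∈ effDom r)
    {L : NNReal} (hpL : LipschitzWith L p) :
    (∀ k ∈ Finset.Icc 1 K, Integrable (fun ω => ‖x k ω - p (x k ω)‖ ^ 2) P) ∧
    a * (ρbar - ρ) * ρbar / 8 * ∑ k ∈ Finset.Icc 1 K, ∫ ω, ‖x k ω - p (x k ω)‖ ^ 2 ∂P
      ≤ moreau (1 / ρbar) (objective F r) x₀ - optVal (objective F r)
        + (ρbar * (2 + 4 / (a * (ρbar - ρ))) * b ^ 2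
            + τ ^ 2 * ρbar * ρ ^ 2 / 2 * (a ^ 2 + a / (ρbar - ρ)))
          * ((a * ((objective F r x₀).toReal - optVal (objective F r)) + a ^ 2 * (K * σ ^ 2))
            / (1 / 2 - a * ρ / 2 - τ ^ 2 * a ^ 2 * ρ ^ 2 - b))
        + ρbar / 2 * a ^ 2 * (K * σ ^ 2) := by
  have hpos : 0 < ρbar := hρ.trans_lt hρbar
  have hδ : 0 < ρbar - ρ := by linarith
  obtain ⟨LV, V, hVL, hV⟩ := hF.exists_lipschitzWith_eq_gradient
  have h01 : ∀ ω, x 0 ω = x 1 ω := fun ω => by rw [hrun.init_zero, hrun.init_one]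
  have h1 : ∀ ω, x 1 ω ∈ effDom r := fun ω => by rw [hrun.init_one]; exact hrun.init_dom
  have hstep : ∀ ω, ∀ k ∈ Finset.Icc 1 K, IsProx a r (x k ω
      - a • sampleGrad f (x (k - delay k ω) ω) (ξ k ω) + b • (x k ω - x (k - 1) ω)) (x (k + 1) ω) :=
    fun ω k hk => hrun.step k hk ω
  have hmem : ∀ ω, ∀ k ≤ K + 1, x k ω ∈ effDom r := fun ω =>
    path_mem_effDom (x := fun k => x k ω)
      (g := fun k => sampleGrad f (x (k - delay k ω) ω) (ξ k ω)) (h01 ω) (h1 ω) (hstep ω)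
  have hxm := hrun.measurable hf hr (fun _ _ => ha) hs
  have hxm' : ∀ k ≤ K + 1, Measurable (x k) := fun k hk => (hxm k hk).mono (ℱ.le k) le_rfl
  have hξm : ∀ k ∈ Finset.Icc 1 K, Measurable (ξ k) := fun k hk =>
    (hs.sample_meas k hk).mono (ℱ.le _) le_rfl
  set Y : ℕ → Ω → Vec n := fun k ω => x (k - delay k ω) ω with hYdef
  have hYmem : ∀ k ∈ Finset.Icc 1 K, ∀ ω, Y k ω ∈ effDom r := fun k hk ω =>
    hmem ω _ (by simp at hk; omega)
  have hYm : ∀ k ∈ Finset.Icc 1 K, Measurable[ℱ k] (Y k) := fun k hk =>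
    measurable_delayed (m := ℱ k) (fun j hj => (hxm j (by simp at hk; omega)).mono (ℱ.mono hj) le_rfl)
      (hs.delay_meas k hk)
  have hYm' : ∀ k ∈ Finset.Icc 1 K, Measurable (Y k) := fun k hk =>
    (hYm k hk).mono (ℱ.le k) le_rfl
  set e : ℕ → Ω → Vec n := fun k ω => sampleGrad f (Y k ω) (ξ k ω) - gradient F (Y k ω) with hedef
  have heV : ∀ k ∈ Finset.Icc 1 K, e k = fun ω => sampleGrad f (Y k ω) (ξ k ω) - V (Y k ω) :=
    fun k hk => funext fun ω => by simp only [hedef, hV _ (hYmem k hk ω)]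
  have hvarY : ∀ k ∈ Finset.Icc 1 K, ∀ ω,
      ∫⁻ s, ENNReal.ofReal (‖sampleGrad f (Y k ω) s - V (Y k ω)‖ ^ 2) ∂D
        ≤ ENNReal.ofReal (σ ^ 2) := by
    intro k hk ω
    rw [hV _ (hYmem k hk ω), hFf]
    exact hvar _ (hYmem k hk ω)
  have hnoise : ∀ k ∈ Finset.Icc 1 K, MemLp (e k) 2 P ∧ ∫ ω, ‖e k ω‖ ^ 2 ∂P ≤ σ ^ 2 := by
    intro k hk
    rw [heV k hk]
    exact memLp_noise (ℱ.le k) (hYm k hk) (hξm k hk) (hs.sample_law k hk) (hs.sample_indep k hk)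
      hf hVL.continuous.measurable (hvarY k hk)
  have heint : ∀ k ∈ Finset.Icc 1 K, Integrable (fun ω => ‖e k ω‖ ^ 2) P := fun k hk =>
    (memLp_two_iff_integrable_sq_norm (hnoise k hk).1.1).1 (hnoise k hk).1
  have hesum : ∑ k ∈ Finset.Icc 1 K, ∫ ω, ‖e k ω‖ ^ 2 ∂P ≤ K * σ ^ 2 := by
    refine (Finset.sum_le_sum fun k hk => (hnoise k hk).2).trans_eq ?_
    simp
  set γ := 1 / 2 - a * ρ / 2 - τ ^ 2 * a ^ 2 * ρ ^ 2 - b with hγdef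
  set d : ℕ → Ω → Vec n := fun k ω => x (k + 1) ω - x k ω with hddef
  have hdm : ∀ k ∈ Finset.Icc 1 K, Measurable (d k) := fun k hk =>
    (hxm' _ (by simp at hk; omega)).sub (hxm' _ (by simp at hk; omega))
  have hpathA : ∀ ω, γ * ∑ k ∈ Finset.Icc 1 K, ‖d k ω‖ ^ 2
      ≤ a * ((objective F r x₀).toReal - optVal (objective F r))
        + a ^ 2 * ∑ k ∈ Finset.Icc 1 K, ‖e k ω‖ ^ 2 := by
    intro ω
    have h := sum_norm_sub_sq_le (x := fun k => x k ω) (t := fun k => delay k ω)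
      (g := fun k => sampleGrad f (x (k - delay k ω) ω) (ξ k ω)) hr hF hbd ha hb (h01 ω) (h1 ω)
      (hstep ω) (fun k hk => hdelay k hk ω)
    rwa [hrun.init_one] at h
  have hsum_e : Integrable (fun ω => a * ((objective F r x₀).toReal - optVal (objective F r))
        + a ^ 2 * ∑ k ∈ Finset.Icc 1 K, ‖e k ω‖ ^ 2) P :=
    (integrable_const _).add ((integrable_finsetSum _ heint).const_mul _)
  -- No moment bound on the iterates is assumed: the pathwise estimate dominates each squared step
  -- by the integrable noise. Square integrability of the iterates then follows by summing steps.
  have hdint : ∀ k ∈ Finset.Icc 1 K, Integrable (fun ω => ‖d k ω‖ ^ 2) P := by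
    intro k hk
    refine (hsum_e.const_mul γ⁻¹).mono' ((hdm k hk).norm.pow_const 2).aestronglyMeasurable
      (Eventually.of_forall fun ω => ?_)
    rw [Real.norm_of_nonneg (sq_nonneg _), inv_mul_eq_div, le_div_iff₀ hγ, mul_comm]
    refine le_trans (mul_le_mul_of_nonneg_left ?_ hγ.le) (hpathA ω)
    exact Finset.single_le_sum (f := fun k => ‖d k ω‖ ^ 2) (fun _ _ => sq_nonneg _) hk
  have hdsum : ∑ k ∈ Finset.Icc 1 K, ∫ ω, ‖d k ω‖ ^ 2 ∂P
      ≤ (a * ((objective F r x₀).toReal - optVal (objective F r)) + a ^ 2 * (K * σ ^ 2)) / γ := by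
    have h := integral_mono ((integrable_finsetSum _ hdint).const_mul γ) hsum_e hpathA
    rw [integral_const_mul, integral_finsetSum _ hdint,
      integral_add (integrable_const _) ((integrable_finsetSum _ heint).const_mul _),
      integral_const, probReal_univ, one_smul, integral_const_mul,
      integral_finsetSum _ heint] at h
    rw [le_div_iff₀ hγ, mul_comm]
    have := mul_le_mul_of_nonneg_left hesum (sq_nonneg a)
    linarith
  have hxL : ∀ k ≤ K + 1, MemLp (x k) 2 P := by
    intro k hk
    induction k with
    | zero =>
      rw [show x 0 = fun _ => x₀ from funext hrun.init_zero]
      exact memLp_const _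
    | succ k ih =>
      rcases Nat.eq_zero_or_pos k with rfl | hk0
      · rw [show x (0 + 1) = fun _ => x₀ from funext hrun.init_one]
        exact memLp_const _
      · have hkK : k ∈ Finset.Icc 1 K := Finset.mem_Icc.2 ⟨hk0, by omega⟩
        have hd2 : MemLp (d k) 2 P :=
          (memLp_two_iff_integrable_sq_norm (hdm k hkK).aestronglyMeasurable).2 (hdint k hkK)
        have h := (ih (by omega)).add hd2
        simpa only [hddef, Pi.add_def, add_sub_cancel] using h
  have hDL : ∀ k ≤ K + 1, MemLp (fun ω => x k ω - p (x k ω)) 2 P := fun k hk =>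
    (hxL k hk).sub (memLp_two_comp_of_lipschitzWith hpL (hxL k hk))
  have hDint : ∀ k ∈ Finset.Icc 1 K, Integrable (fun ω => ‖x k ω - p (x k ω)‖ ^ 2) P :=
    fun k hk => (memLp_two_iff_integrable_sq_norm
      (hDL k (by simp at hk; omega)).1).1 (hDL k (by simp at hk; omega))
  refine ⟨hDint, ?_⟩
  set u : ℕ → Ω → Vec n := fun k ω =>
    drift F ρbar a b (x k ω) (x (k - 1) ω) (Y k ω) (p (x k ω)) with hudef
  have huV : ∀ k ∈ Finset.Icc 1 K, u k = fun ω => (1 - a * ρbar) • (x k ω - p (x k ω))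
      - a • (V (Y k ω) - V (p (x k ω))) + b • (x k ω - x (k - 1) ω) :=
    fun k hk => funext fun ω => by
      simp only [hudef, drift, hV _ (hYmem k hk ω), hV _ (hpd _)]
  -- The drift involves only iterates up to `k` and the delay, all known before the sample `ξ k`.
  have hum : ∀ k ∈ Finset.Icc 1 K, Measurable[ℱ k] (u k) := by
    intro k hk
    have hkK : k ≤ K + 1 := by simp at hk; omega
    have m1 := hxm k hkK
    have m2 : Measurable[ℱ k] (x (k - 1)) :=
      (hxm (k - 1) (by omega)).mono (ℱ.mono (by omega)) le_rfl
    have m3 := hYm k hk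
    rw [huV k hk]
    exact measurable_drift (m := ℱ k) m1 m2 m3 hpL.continuous.measurable hVL.continuous.measurable
      _ _ _
  have huL : ∀ k ∈ Finset.Icc 1 K, MemLp (u k) 2 P := by
    intro k hk
    have hkK : k ≤ K + 1 := by simp at hk; omega
    have hY2 : MemLp (Y k) 2 P := memLp_two_delayed (fun j hj => hxL j (by omega))
      (hYm' k hk).aestronglyMeasurable
    rw [huV k hk]
    exact memLp_two_drift (hxL k hkK) (hxL (k - 1) (by omega)) hY2 hpL hVL _ _ _
  have huint : ∀ k ∈ Finset.Icc 1 K, Integrable (fun ω => ⟪u k ω, e k ω⟫_ℝ) P := by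
    intro k hk
    refine ((huL k hk).norm.integrable_mul (hnoise k hk).1.norm).mono'
      ((huL k hk).1.inner (hnoise k hk).1.1) (Eventually.of_forall fun ω => ?_)
    exact norm_inner_le_norm _ _
  have huzero : ∀ k ∈ Finset.Icc 1 K, ∫ ω, ⟪u k ω, e k ω⟫_ℝ ∂P = 0 := by
    intro k hk
    have hi := huint k hk
    rw [heV k hk] at hi ⊢
    refine integral_inner_noise_eq_zero (ℱ.le k) (hYm k hk) (hum k hk) (hξm k hk)
      (hs.sample_law k hk) (hs.sample_indep k hk) hf hVL.continuous.measurable (hvarY k hk) ?_ hi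
    filter_upwards [hunb k hk] with ω hω
    rw [hV _ (hYmem k hk ω), hFf]
    exact hω
  have hpathB : ∀ ω, a * (ρbar - ρ) * ρbar / 8 * ∑ k ∈ Finset.Icc 1 K, ‖x k ω - p (x k ω)‖ ^ 2
      ≤ moreau (1 / ρbar) (objective F r) x₀ - optVal (objective F r)
        + (ρbar * (2 + 4 / (a * (ρbar - ρ))) * b ^ 2
            + τ ^ 2 * ρbar * ρ ^ 2 / 2 * (a ^ 2 + a / (ρbar - ρ)))
          * ∑ k ∈ Finset.Icc 1 K, ‖d k ω‖ ^ 2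
        + ρbar / 2 * a ^ 2 * ∑ k ∈ Finset.Icc 1 K, ‖e k ω‖ ^ 2
        - ρbar * a * ∑ k ∈ Finset.Icc 1 K, ⟪u k ω, e k ω⟫_ℝ := by
    intro ω
    have h := sum_norm_sub_prox_sq_le (x := fun k => x k ω) (t := fun k => delay k ω)
      (g := fun k => sampleGrad f (x (k - delay k ω) ω) (ξ k ω)) hr hF hbd hρ hρbar ha hb haρ
      (h01 ω) (h1 ω) (hstep ω) (fun k hk => hdelay k hk ω) hp hpd
    rwa [hrun.init_one] at h
  set C := ρbar * (2 + 4 / (a * (ρbar - ρ))) * b ^ 2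
            + τ ^ 2 * ρbar * ρ ^ 2 / 2 * (a ^ 2 + a / (ρbar - ρ)) with hC
  have hCnn : 0 ≤ C := by positivity
  have i1 := (integrable_const (μ := P)
    (moreau (1 / ρbar) (objective F r) x₀ - optVal (objective F r)))
  have i2 := (integrable_finsetSum _ hdint).const_mul C
  have i3 := (integrable_finsetSum _ heint).const_mul (ρbar / 2 * a ^ 2)
  have i4 := (integrable_finsetSum _ huint).const_mul (ρbar * a)
  have h := integral_mono ((integrable_finsetSum _ hDint).const_mul (a * (ρbar - ρ) * ρbar / 8))
    (((i1.add i2).add i3).sub i4) hpathB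
  rw [integral_sub' ((i1.add i2).add i3) i4, integral_add' (i1.add i2) i3, integral_add' i1 i2,
    integral_const_mul, integral_const_mul, integral_const_mul, integral_const_mul,
    integral_finsetSum _ hdint, integral_finsetSum _ heint, integral_finsetSum _ huint,
    integral_finsetSum _ hDint, integral_const, probReal_univ, one_smul,
    Finset.sum_eq_zero huzero, mul_zero, sub_zero] at h
  have j1 := mul_le_mul_of_nonneg_left hdsum hCnn
  have j2 := mul_le_mul_of_nonneg_left hesum (by positivity : 0 ≤ ρbar / 2 * a ^ 2)
  linarith

end Expectation

end InertialSGM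

/-! ### The convergence rate. -/

theorem mainTheorem2 {n : ℕ} {Ω Ξ : Type*} {mΩ : MeasurableSpace Ω} [MeasurableSpace Ξ]
    -- the problem: loss `f`, law `D` of the random sample, regularizer `r`
    (P : MeasureTheory.Measure Ω) [MeasureTheory.IsProbabilityMeasure P]
    (D : MeasureTheory.Measure Ξ) [MeasureTheory.IsProbabilityMeasure D]
    (r : Vec n → EReal) (hr : ProperClosedConvex r)
    (f : Vec n → Ξ → ℝ) (hf_int : ∀ x, MeasureTheory.Integrable (f x) D)
    (hf_diff : ∀ x ∈ effDom r, ∀ᵐ s ∂D, DifferentiableAt ℝ (fun y => f y s) x)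
    (hf_meas : Measurable (fun p : Vec n × Ξ => sampleGrad f p.1 p.2))
    (F : Vec n → ℝ) (hF : F = expLoss D f)
    (φ : Vec n → EReal) (hφ : φ = objective F r) (hφ_bdd : (⨅ x, φ x) ≠ ⊥)
    -- smoothness and bounded variance
    (ρ σ : ℝ) (hρ : 0 ≤ ρ) (hσ : 0 ≤ σ)
    (hsmooth : SmoothIn ρ F (effDom r))
    (hvar : BoundedVariance D f σ (effDom r))
    -- parameters
    (ρbar : ℝ) (hρbar : ρ < ρbar) (K : ℕ) (hK : 1 ≤ K) (τ : ℕ)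
    (α β : ℝ) (hα : 0 < α) (hβ : 0 ≤ β)
    (hstep : α / √(K : ℝ) ≤ 1 / ρbar)
    (γ : ℝ)
    (hγ : γ = 1 / 2 - α * ρ / (2 * √(K : ℝ)) - (τ : ℝ) ^ 2 * α ^ 2 * ρ ^ 2 / K
      - β / (K : ℝ) ^ (1 / 4 : ℝ))
    (hγ_pos : 0 < γ)
    -- the run of the algorithm, with bounded delays and unbiased sample gradients
    (a b : ℕ → ℝ) (ha : ∀ k ∈ Finset.Icc 1 K, a k = α / √(K : ℝ))
    (hb : ∀ k ∈ Finset.Icc 1 K, b k = β / (K : ℝ) ^ (1 / 4 : ℝ))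
    (ℱ : MeasureTheory.Filtration ℕ mΩ) (ξ : ℕ → Ω → Ξ) (delay : ℕ → Ω → ℕ)
    (hsample : IsSampling P D ℱ ξ delay K)
    (hdelay : ∀ k ∈ Finset.Icc 1 K, ∀ ω, delay k ω ≤ τ)
    (x₀ : Vec n) (x : ℕ → Ω → Vec n)
    (hrun : IsInertialRun f r a b ξ delay K x₀ x)
    (hunbiased : UnbiasedAlong P D f delay K x)
    (T : Ω → ℕ) (hT : IsRandomIndex P a K x T) :
    Differentiable ℝ (moreau (1 / ρbar) φ) ∧
    MeasureTheory.Integrable (fun ω => ‖gradient (moreau (1 / ρbar) φ) (x (T ω) ω)‖ ^ 2) P ∧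
    ∫ ω, ‖gradient (moreau (1 / ρbar) φ) (x (T ω) ω)‖ ^ 2 ∂P
      ≤ 8 * ρbar / ((ρbar - ρ) * α * √(K : ℝ)) *
        (moreau (1 / ρbar) φ x₀ - optVal φ + σ ^ 2 * ρbar * α ^ 2 / 2
          + 1 / γ *
            (ρbar * (2 + 4 * √(K : ℝ) / (α * (ρbar - ρ))) * (β ^ 2 / √(K : ℝ))
              + (τ : ℝ) ^ 2 * ρbar * ρ ^ 2 / 2
                * (α ^ 2 / K + α / ((ρbar - ρ) * √(K : ℝ)))) *
            (α / √(K : ℝ) * ((φ x₀).toReal - optVal φ) + α ^ 2 * σ ^ 2)) := by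
  have hpos : 0 < ρbar := hρ.trans_lt hρbar
  have hδ : 0 < ρbar - ρ := by linarith
  have hKpos : (0 : ℝ) < K := by exact_mod_cast hK
  have hsK : 0 < √(K : ℝ) := Real.sqrt_pos.2 hKpos
  have hsq : √(K : ℝ) ^ 2 = K := Real.sq_sqrt hKpos.le
  have hqsq : ((K : ℝ) ^ (1 / 4 : ℝ)) ^ 2 = √(K : ℝ) := by
    rw [← Real.rpow_natCast, ← Real.rpow_mul hKpos.le, Real.sqrt_eq_rpow]
    norm_num
  set a' := α / √(K : ℝ) with ha'
  set b' := β / (K : ℝ) ^ (1 / 4 : ℝ) with hb'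
  have ha'pos : 0 < a' := div_pos hα hsK
  have hb'nn : 0 ≤ b' := by positivity
  have ha'ρ : a' * ρbar ≤ 1 := by rwa [le_div_iff₀ hpos] at hstep
  have ea2 : α ^ 2 / K = a' ^ 2 := by rw [ha', div_pow, hsq]
  have eb2 : β ^ 2 / √(K : ℝ) = b' ^ 2 := by rw [hb', div_pow, hqsq]
  have hα' : α = a' * √(K : ℝ) := by rw [ha']; field_simp
  have hγ' : γ = 1 / 2 - a' * ρ / 2 - (τ : ℝ) ^ 2 * a' ^ 2 * ρ ^ 2 - b' := by
    rw [hγ, ← ea2, ha']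
    ring
  subst hφ
  have hrun' : IsInertialRun f r (fun _ => a') (fun _ => b') ξ delay K x₀ x :=
    ⟨hrun.init_dom, hrun.init_zero, hrun.init_one, fun k hk ω => by
      have h := hrun.step k hk ω
      rwa [ha k hk, hb k hk] at h⟩
  choose p hp using exists_isProx_objective hr hsmooth hφ_bdd (one_div_pos.2 hpos)
  have hpd : ∀ y, p y ∈ effDom r := fun y => by
    have h : p y ∈ effDom (objective F r) :=
      (hp y).mem_effDom (y := x₀) (by rw [effDom_objective]; exact hrun.init_dom)
    rwa [effDom_objective] at h
  have hpL : LipschitzWith (ρbar / (ρbar - ρ)).toNNReal p := by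
    refine LipschitzWith.of_dist_le_mul fun y z => ?_
    rw [dist_eq_norm, dist_eq_norm, Real.coe_toNNReal _ (by positivity), div_mul_eq_mul_div,
      le_div_iff₀ hδ, mul_comm]
    exact (hp y).norm_sub_le_of_smoothIn hr hsmooth (hpd y) (hp z) (hpd z) hpos.le
  have hgrad := hasGradientAt_moreau hr hsmooth hρ hρbar hp hpd
  have hnorm : ∀ y, ‖gradient (moreau (1 / ρbar) (objective F r)) y‖ ^ 2
      = ρbar ^ 2 * ‖y - p y‖ ^ 2 := fun y => by
    rw [(hgrad y).gradient, norm_smul, Real.norm_of_nonneg hpos.le, mul_pow]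
  obtain ⟨hint, hbound⟩ := hrun'.sum_integral_norm_sub_prox_sq_le hr hf_meas hF hφ_bdd hρ hρbar
    hsmooth hvar ha'pos hb'nn ha'ρ (hγ' ▸ hγ_pos) hsample hdelay hunbiased hp hpd hpL
  have hsum : ∑ j ∈ Finset.Icc 1 K, a j = K * a' := by
    rw [Finset.sum_congr rfl ha]
    simp
  have hTint := hT.integral_comp (by rw [hsum]; positivity)
    (q := fun y => ρbar ^ 2 * ‖y - p y‖ ^ 2)
    ((((continuous_id.sub hpL.continuous).norm.pow 2).const_mul _).measurable)
    (fun k hk => (hint k hk).const_mul _)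
  refine ⟨fun y => (hgrad y).differentiableAt, ?_, ?_⟩
  · simpa only [hnorm] using hTint.1
  simp only [hnorm]
  rw [hTint.2, hsum, Finset.sum_congr rfl fun k hk => by
    rw [ha k hk, MeasureTheory.integral_const_mul], ← Finset.mul_sum, ← Finset.mul_sum]
  rw [← hγ'] at hbound
  set I := ∑ k ∈ Finset.Icc 1 K, ∫ ω, ‖x k ω - p (x k ω)‖ ^ 2 ∂P
  -- Each index has probability `1 / K`. Since `K * a' = α * √K`, the prefactor of the theorem is
  -- what restores the coefficient of the expected sum.
  have e1 : a' / (K * a') * (ρbar ^ 2 * I)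
      = 8 * ρbar / ((ρbar - ρ) * α * √(K : ℝ)) * (a' * (ρbar - ρ) * ρbar / 8 * I) := by
    have : (K : ℝ) * a' = α * √(K : ℝ) := by
      rw [hα', mul_assoc, ← sq, hsq, mul_comm]
    rw [this]
    field_simp
  rw [e1]
  refine mul_le_mul_of_nonneg_left (hbound.trans_eq ?_) (by positivity)
  have e2 : 4 * √(K : ℝ) / (α * (ρbar - ρ)) = 4 / (a' * (ρbar - ρ)) := by
    rw [ha']
    field_simp
  have e3 : α / ((ρbar - ρ) * √(K : ℝ)) = a' / (ρbar - ρ) := by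
    rw [ha', div_div, mul_comm]
  have e4 : a' ^ 2 * (K * σ ^ 2) = α ^ 2 * σ ^ 2 := by
    rw [hα', mul_pow, hsq]
    ring
  rw [ea2, eb2, e2, e3, mul_assoc (ρbar / 2), e4]
  ring
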